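/- The model of computation is the word RAM with words of $O(\log N)$ bits, where $N$ is the length of the input in words: the hidden constant may depend on the algorithm, and every instruction (arithmetic, bitwise operation, memory access through a register, jump) costs one step. For two sequences $x,y$ of $n\ge 1$ symbols over an alphabet $\Sigma$, a traversal starts with one marker at the first symbol of $x$ and one at the first symbol of $y$; in every step one or both of the markers move one symbol forward; it ends when both markers are at the last symbols of their sequences. Its cost is the number of its configurations (including the first and the last) in which the two markers point at different symbols. $\mathrm{DTWD}(x,y)$ is the minimum cost of a traversal. In Most-Orthogonal Vectors, the input consists of two lists $\{\alpha_i\}_{i\in[n]}$ and $\{\beta_i\}_{i\in[n]}$ of vectors in $\{0,1\}^d$, where $n,d\ge 1$, and an integer $r\in\{0,\dots,d\}$; the task is to decide whether there are $i,j\in[n]$ with $\sum_{h=1}^d \alpha_i[h]\,\beta_j[h]\le r$. **Theorem.** Suppose that, for some $\varepsilon>0$, there is an algorithm that computes $\mathrm{DTWD}(x,y)$ for any two sequences $x,y$ of length $n$ over an alphabet of size $5$ in $O(n^{2-\varepsilon})$ time. Then, for some $\varepsilon'>0$, there is an algorithm that solves Most-Orthogonal Vectors on two lists of $n$ vectors in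 $\{0,1\}^d$ in $O(n^{2-\varepsilon'}\cdot\mathrm{poly}(d))$ time. -/

import Mathlib

/-! ### Word RAM

A word RAM has registers and a random-access memory, both indexed by natural numbers and both
holding words of `w` bits, that is, natural numbers below `2 ^ w`.  Every instruction costs one
step.  An operation whose result does not fit into a word is a fault, after which there is no
further step, so an algorithm has to keep its values within the word size. -/

namespace WordRAM

/-- The arithmetic and bitwise operations on words (subtraction is truncated at `0`). -/
inductive BinOp where
  | add | sub | mul | div | mod | and | or | xor | shl | shr

/-- The value of an operation on natural numbers. -/
def BinOp.eval : BinOp → ℕ → ℕ → ℕ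
  | .add, a, b => a + b
  | .sub, a, b => a - b
  | .mul, a, b => a * b
  | .div, a, b => a / b
  | .mod, a, b => a % b
  | .and, a, b => a &&& b
  | .or, a, b => a ||| b
  | .xor, a, b => a ^^^ b
  | .shl, a, b => a <<< b
  | .shr, a, b => a >>> b

/-- Instructions; the arguments are fixed numbers written in the program. -/
inductive Instr where
  /-- `reg[dst] := v` -/
  | const (dst v : ℕ)
  /-- `reg[dst] := o (reg[a]) (reg[b])` -/
  | op (o : BinOp) (dst a b : ℕ)
  /-- `reg[dst] := mem[reg[addr]]` -/
  | load (dst addr : ℕ)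
  /-- `mem[reg[addr]] := reg[src]` -/
  | store (addr src : ℕ)
  /-- continue at instruction number `target` -/
  | jump (target : ℕ)
  /-- continue at instruction number `target` if `reg[a] = 0`, else at the next instruction -/
  | jumpIfZero (a target : ℕ)
  /-- stop -/
  | halt

/-- A program is a finite list of instructions, numbered from `0`. -/
abbrev Program := List Instr

/-- A configuration: program counter, registers, memory. -/
structure State where
  pc : ℕ
  reg : ℕ → ℕ
  mem : ℕ → ℕ

/-- Write `v` to register `dst` and go to the next instruction; a fault if `v` is no word. -/
def State.setReg (w : ℕ) (s : State) (dst v : ℕ) : Option State :=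
  if v < 2 ^ w then
    some { pc := s.pc + 1, reg := Function.update s.reg dst v, mem := s.mem }
  else none

/-- One step of the program `P` with words of `w` bits. There is no next configuration if the
machine has halted, has run out of the program, or has a fault. -/
def step (w : ℕ) (P : Program) (s : State) : Option State :=
  match P[s.pc]? with
  | none => none
  | some .halt => none
  | some (.const dst v) => s.setReg w dst v
  | some (.op o dst a b) => s.setReg w dst (o.eval (s.reg a) (s.reg b))
  | some (.load dst addr) => s.setReg w dst (s.mem (s.reg addr))
  | some (.store addr src) =>
      some { pc := s.pc + 1, reg := s.reg,
             mem := Function.update s.mem (s.reg addr) (s.reg src) }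
  | some (.jump target) => some { pc := target, reg := s.reg, mem := s.mem }
  | some (.jumpIfZero a target) =>
      some { pc := if s.reg a = 0 then target else s.pc + 1, reg := s.reg, mem := s.mem }

/-- The configuration after exactly `t` steps, if there is one. -/
def run (w : ℕ) (P : Program) : ℕ → State → Option State
  | 0, s => some s
  | t + 1, s => (step w P s).bind (run w P t)

/-- The initial configuration on the input `x`, a list of words: the input stands in the memory
cells `0, 1, …, x.length - 1`, all other cells and all registers are `0`. -/
def init (x : List ℕ) : State where
  pc := 0
  reg := fun _ => 0
  mem := fun i => x.getD i 0

/-- On the input `x` and with words of `w` bits, the program `P` halts after exactly `t` steps,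
without a fault, with `v` in register `0`. -/
def Outputs (w : ℕ) (P : Program) (x : List ℕ) (t v : ℕ) : Prop :=
  ∃ s : State, run w P t (init x) = some s ∧ P[s.pc]? = some Instr.halt ∧ s.reg 0 = v

/-- The word size `c * ⌈log₂ (N + 1)⌉`, where `N` is the length of the input `x`: words have
`O(log N)` bits, where the constant `c` belongs to the algorithm. -/
def wordSize (c : ℕ) (x : List ℕ) : ℕ := c * Nat.clog 2 (x.length + 1)

end WordRAM

/-! ### Dynamic time warping distance -/

/-- One step of a traversal: one or both of the markers move one point forward. -/
def MarkerMove {m n : ℕ} (p q : Fin m × Fin n) : Prop :=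
  (q.1.val = p.1.val + 1 ∧ q.2.val = p.2.val) ∨
  (q.1.val = p.1.val ∧ q.2.val = p.2.val + 1) ∨
  (q.1.val = p.1.val + 1 ∧ q.2.val = p.2.val + 1)

/-- A traversal of sequences of length `m` and `n`, as the list of all the pairs of positions of
the two markers: both start at the first point, both end at the last point. -/
structure IsTraversal {m n : ℕ} (T : List (Fin m × Fin n)) : Prop where
  start : ∃ p ∈ T.head?, p.1.val = 0 ∧ p.2.val = 0
  finish : ∃ p ∈ T.getLast?, p.1.val + 1 = m ∧ p.2.val + 1 = n
  moves : T.IsChain MarkerMove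

/-- The cost of a traversal: the sum of the distances `δ` over all its configurations. -/
def traversalCost {S M : Type*} [AddCommMonoid M] (δ : S → S → M) {m n : ℕ}
    (x : Fin m → S) (y : Fin n → S) (T : List (Fin m × Fin n)) : M :=
  (T.map fun p => δ (x p.1) (y p.2)).sum

/-- `v` is the dynamic time warping distance of `x` and `y` for the distance function `δ`: the
minimum cost of a traversal. -/
def IsDTWD {S M : Type*} [AddCommMonoid M] [Preorder M] (δ : S → S → M) {m n : ℕ}
    (x : Fin m → S) (y : Fin n → S) (v : M) : Prop :=
  IsLeast {k : M | ∃ T : List (Fin m × Fin n), IsTraversal T ∧ traversalCost δ x y T = k} v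

/-- The distance between symbols: `0` if they are equal and `1` otherwise. -/
def symbolDist {S : Type*} [DecidableEq S] (s t : S) : ℕ := if s = t then 0 else 1

/-- The input of the DTWD problem: the length, the first sequence, the second sequence. -/
def encodeSequences {σ n : ℕ} (x y : Fin n → Fin σ) : List ℕ :=
  n :: (List.ofFn (fun i => (x i).val) ++ List.ofFn (fun i => (y i).val))

/-- DTWD of two sequences of `n` symbols from an alphabet of size `σ` can be computed in time
`O(n ^ (2 - ε))` for some `ε > 0`. -/
def DTWDStronglySubquadratic (σ : ℕ) : Prop :=
  ∃ ε : ℝ, 0 < ε ∧ ∃ (C : ℝ) (c : ℕ) (P : WordRAM.Program),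
    ∀ n : ℕ, 1 ≤ n → ∀ x y : Fin n → Fin σ, ∃ t v : ℕ,
      WordRAM.Outputs (WordRAM.wordSize c (encodeSequences x y)) P (encodeSequences x y) t v ∧
      IsDTWD symbolDist x y v ∧
      (t : ℝ) ≤ C * (n : ℝ) ^ (2 - ε)

/-! ### Most-Orthogonal Vectors -/

/-- Some `α i` and `β j` have inner product at most `r`. -/
def HasFarPair {n d : ℕ} (α β : Fin n → Fin d → Fin 2) (r : ℕ) : Prop :=
  ∃ i j : Fin n, ∑ h : Fin d, (α i h).val * (β j h).val ≤ r

/-- The input of the Most-Orthogonal Vectors problem: the number of vectors in a list, the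
dimension, the threshold, and the two lists of vectors, coordinate by coordinate. -/
def encodeVectors {n d : ℕ} (α β : Fin n → Fin d → Fin 2) (r : ℕ) : List ℕ :=
  n :: d :: r ::
    ((List.ofFn fun i => List.ofFn fun h => (α i h).val).flatten ++
     (List.ofFn fun i => List.ofFn fun h => (β i h).val).flatten)

/-- Most-Orthogonal Vectors for two lists of `n` vectors in `{0,1} ^ d` can be decided (output `1`
for yes and `0` for no) in time `O(n ^ (2 - ε) * poly(d))` for some `ε > 0`. -/
def MostOrthogonalVectorsTrulySubquadratic : Prop :=
  ∃ ε : ℝ, 0 < ε ∧ ∃ (C : ℝ) (k c : ℕ) (P : WordRAM.Program),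
    ∀ n d r : ℕ, 1 ≤ n → 1 ≤ d → r ≤ d → ∀ α β : Fin n → Fin d → Fin 2, ∃ t v : ℕ,
      WordRAM.Outputs (WordRAM.wordSize c (encodeVectors α β r)) P (encodeVectors α β r) t v ∧
      (HasFarPair α β r → v = 1) ∧ (¬ HasFarPair α β r → v = 0) ∧
      (t : ℝ) ≤ C * (n : ℝ) ^ (2 - ε) * (d : ℝ) ^ k

/-!
The statement is a reduction from Most-Orthogonal Vectors to the distance of two sequences over five
symbols, carried out by a word-RAM program.

**Vector gadgets.** Each vector becomes a word with one block per coordinate; a block starts with a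
long run of `2` and ends with a long run of `3`, and the symbols between the runs code the
coordinate. Aligning block with block, the gadgets of vectors `a` and `b` with `m` coordinates have
a traversal of cost `m` plus their inner product (`alignCost_gadgets`). No traversal is cheaper,
unless it costs at least the length `K` of a run (`AlignCost.le_of_gadgets`): the symbol `1`,
present in each block of the first gadget, never occurs in the second one, and where both
coordinates are `1`, the symbol `0` of the first gadget could only be matched inside another block.
But if less than `K` is paid, each run is matched, so that the runs before a matched symbol form an
alternating subsequence of the other word (`AlignCost.sublist_of_hasRuns`), which forces equal block
numbers.

**The sequences.** All vectors are extended by `r + 1` coordinates, `0` for the first list and `1`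
for the second one. A dummy vector, which is `1` on the new coordinates only, then has inner product
`r + 1` with all vectors of the second list. The first sequence consists of `n` dummy gadgets, the
`n` gadgets of the first list, and `n` more dummies, separated by long runs of the symbol `4`; the
second one consists of the gadgets of the second list, separated in the same way, and is padded with
symbols `4`. If there is a far pair, its gadgets are aligned, the other gadgets of the second
sequence meet dummies, and the rest of the first sequence is skipped (`alignCost_of_pair`).
Conversely, let `V` be the cost with a dummy, and `L` the length of a gadget. If there is no far
pair, then a gadget of the second sequence that is aligned with a piece `s` of the first one costs
at least the number of symbols of `s` other than `4`, minus `L - V` (`AlignCost.weight_add_le`).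
This bound is linear in `s`, so it adds up over the second sequence
(`AlignCost.weight_add_length_mul_le`). Hence a far pair exists exactly if the distance is below
`costThreshold` (`hasFarPair_iff`).

**The program.** The memory is overwritten with the encoding of the two sequences, from the highest
address downward: each symbol is the value of a fixed arithmetic expression in its address, which
reads only input words that are still intact (`WordRAM.Expr.eval_target`, `WordRAM.run_fillLoop`).
All this uses registers beyond those of the given program, which is then run as a part of the new
one (`WordRAM.Simulates.run`), and its result is compared with the threshold
(`WordRAM.outputs_reduction`). The sequences have length at most `505 * n * d ^ 2`, which yields the
bounds for time and word size.
-/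

/-! ### Costs of traversals of lists -/

/-- `AlignCost x y k`: the nonempty lists `x` and `y` have a traversal of cost `k`. The rules
follow the first step of the two markers. -/
inductive AlignCost {S : Type*} [DecidableEq S] : List S → List S → ℕ → Prop
  | single (a b : S) : AlignCost [a] [b] (symbolDist a b)
  | left (a b : S) {x y : List S} {k : ℕ} (h : AlignCost x (b :: y) k) :
      AlignCost (a :: x) (b :: y) (symbolDist a b + k)
  | right (a b : S) {x y : List S} {k : ℕ} (h : AlignCost (a :: x) y k) :
      AlignCost (a :: x) (b :: y) (symbolDist a b + k)
  | diag (a b : S) {x y : List S} {k : ℕ} (h : AlignCost x y k) :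
      AlignCost (a :: x) (b :: y) (symbolDist a b + k)

section SymbolDist

variable {S : Type*} [DecidableEq S]

theorem symbolDist_comm (a b : S) : symbolDist a b = symbolDist b a := by
  simp [symbolDist, eq_comm]

theorem symbolDist_of_ne {a b : S} (h : a ≠ b) : symbolDist a b = 1 := by simp [symbolDist, h]

theorem symbolDist_le_one (a b : S) : symbolDist a b ≤ 1 := by
  unfold symbolDist; split <;> simp

theorem symbolDist_eq_zero {a b : S} : symbolDist a b = 0 ↔ a = b := by
  unfold symbolDist; split <;> simp_all

end SymbolDist

namespace AlignCost

variable {S : Type*} [DecidableEq S]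

theorem left_ne_nil {x y : List S} {k : ℕ} (h : AlignCost x y k) : x ≠ [] := by
  cases h <;> simp

theorem right_ne_nil {x y : List S} {k : ℕ} (h : AlignCost x y k) : y ≠ [] := by
  cases h <;> simp

theorem symm {x y : List S} {k : ℕ} (h : AlignCost x y k) : AlignCost y x k := by
  induction h with
  | single a b => rw [symbolDist_comm]; exact .single b a
  | left a b _ ih => rw [symbolDist_comm]; exact .right b a ih
  | right a b _ ih => rw [symbolDist_comm]; exact .left b a ih
  | diag a b _ ih => rw [symbolDist_comm]; exact .diag b a ih

/-- A traversal of `x` and `y₁ ++ y₂` splits where the second marker passes from `y₁` to `y₂`;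
in this step the first marker may stay on its symbol, which then belongs to both parts. -/
theorem split_right {x y₁ y₂ : List S} {k : ℕ} (h : AlignCost x (y₁ ++ y₂) k)
    (h₁ : y₁ ≠ []) (h₂ : y₂ ≠ []) :
    ∃ k₁ k₂, k₁ + k₂ = k ∧
      ((∃ x₁ x₂, x = x₁ ++ x₂ ∧ AlignCost x₁ y₁ k₁ ∧ AlignCost x₂ y₂ k₂) ∨
       (∃ u c v, x = u ++ c :: v ∧ AlignCost (u ++ [c]) y₁ k₁ ∧ AlignCost (c :: v) y₂ k₂)) := by
  generalize hy : y₁ ++ y₂ = y at h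
  induction h generalizing y₁ with
  | single a b =>
    cases y₁ with
    | nil => exact absurd rfl h₁
    | cons b' y₁ => simp_all
  | @left a b x y k h ih =>
    obtain ⟨k₁, k₂, hk, h'⟩ := ih h₁ hy
    obtain ⟨b', y₁, rfl⟩ := List.exists_cons_of_ne_nil h₁
    obtain ⟨rfl, rfl⟩ : b' = b ∧ y₁ ++ y₂ = y := by simpa using hy
    refine ⟨symbolDist a b' + k₁, k₂, by omega, ?_⟩
    rcases h' with ⟨x₁, x₂, rfl, ha, hb⟩ | ⟨u, c, v, rfl, ha, hb⟩
    · exact .inl ⟨a :: x₁, x₂, rfl, .left a b' ha, hb⟩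
    · exact .inr ⟨a :: u, c, v, rfl, .left a b' ha, hb⟩
  | @right a b x y k h ih =>
    obtain ⟨b', y₁, rfl⟩ := List.exists_cons_of_ne_nil h₁
    obtain ⟨rfl, rfl⟩ : b' = b ∧ y₁ ++ y₂ = y := by simpa using hy
    rcases eq_or_ne y₁ [] with rfl | hne
    · exact ⟨_, _, rfl, .inr ⟨[], a, x, rfl, .single a b', h⟩⟩
    obtain ⟨k₁, k₂, hk, h'⟩ := ih hne rfl
    refine ⟨symbolDist a b' + k₁, k₂, by omega, ?_⟩
    rcases h' with ⟨x₁, x₂, hx, ha, hb⟩ | ⟨u, c, v, hx, ha, hb⟩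
    · obtain ⟨a', x₁, rfl⟩ := List.exists_cons_of_ne_nil ha.left_ne_nil
      obtain ⟨rfl, rfl⟩ : a = a' ∧ x = x₁ ++ x₂ := by simpa using hx
      exact .inl ⟨a :: x₁, x₂, rfl, .right a b' ha, hb⟩
    · refine .inr ⟨u, c, v, hx, ?_, hb⟩
      cases u with
      | nil =>
        obtain ⟨rfl, rfl⟩ : a = c ∧ x = v := by simpa using hx
        exact .right a b' ha
      | cons a' u =>
        obtain ⟨rfl, rfl⟩ : a = a' ∧ x = u ++ c :: v := by simpa using hx
        exact .right a b' ha
  | @diag a b x y k h ih =>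
    obtain ⟨b', y₁, rfl⟩ := List.exists_cons_of_ne_nil h₁
    obtain ⟨rfl, rfl⟩ : b' = b ∧ y₁ ++ y₂ = y := by simpa using hy
    rcases eq_or_ne y₁ [] with rfl | hne
    · exact ⟨_, _, rfl, .inl ⟨[a], x, rfl, .single a b', h⟩⟩
    obtain ⟨k₁, k₂, hk, h'⟩ := ih hne rfl
    refine ⟨symbolDist a b' + k₁, k₂, by omega, ?_⟩
    rcases h' with ⟨x₁, x₂, rfl, ha, hb⟩ | ⟨u, c, v, rfl, ha, hb⟩
    · exact .inl ⟨a :: x₁, x₂, rfl, .diag a b' ha, hb⟩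
    · exact .inr ⟨a :: u, c, v, rfl, .diag a b' ha, hb⟩

/-- The weak form of `split_right` that suffices for counting symbols. -/
theorem split_right_countP {x y₁ y₂ : List S} {k : ℕ} (h : AlignCost x (y₁ ++ y₂) k)
    (h₁ : y₁ ≠ []) (h₂ : y₂ ≠ []) :
    ∃ k₁ k₂ x₁ x₂, k₁ + k₂ = k ∧ x₁ <:+: x ∧ x₂ <:+: x ∧ AlignCost x₁ y₁ k₁ ∧
      AlignCost x₂ y₂ k₂ ∧ ∀ p : S → Bool, x.countP p ≤ x₁.countP p + x₂.countP p := by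
  obtain ⟨k₁, k₂, hk, ⟨x₁, x₂, rfl, ha, hb⟩ | ⟨u, c, v, rfl, ha, hb⟩⟩ := h.split_right h₁ h₂
  · exact ⟨k₁, k₂, x₁, x₂, hk, ⟨[], x₂, by simp⟩, ⟨x₁, [], by simp⟩, ha, hb, by simp⟩
  · refine ⟨k₁, k₂, _, _, hk, ⟨[], v, by simp⟩, ⟨u, [], by simp⟩, ha, hb, fun p => ?_⟩
    simp only [List.countP_append]; omega

theorem append {x₁ x₂ y₁ y₂ : List S} {k₁ k₂ : ℕ} (h₁ : AlignCost x₁ y₁ k₁)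
    (h₂ : AlignCost x₂ y₂ k₂) : AlignCost (x₁ ++ x₂) (y₁ ++ y₂) (k₁ + k₂) := by
  induction h₁ with
  | single a b => exact .diag a b h₂
  | left a b _ ih => rw [add_assoc]; exact .left a b ih
  | right a b _ ih => rw [add_assoc]; exact .right a b ih
  | diag a b _ ih => rw [add_assoc]; exact .diag a b ih

/-- The first marker runs over `u` while the second one waits. -/
theorem prepend {x y : List S} {b : S} {k : ℕ} (u : List S) (h : AlignCost x (b :: y) k) :
    AlignCost (u ++ x) (b :: y) (u.countP (· ≠ b) + k) := by
  induction u with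
  | nil => simpa using h
  | cons a u ih =>
    have := AlignCost.left a b ih
    have hcount : (a :: u).countP (· ≠ b) = u.countP (· ≠ b) + symbolDist a b := by
      rw [List.countP_cons]
      by_cases hab : a = b <;> simp [symbolDist, hab]
    rw [hcount, add_comm _ (symbolDist a b), add_assoc]
    exact this

theorem singleton (x : List S) (b : S) (hx : x ≠ []) :
    AlignCost x [b] (x.countP (· ≠ b)) := by
  obtain ⟨u, a, rfl⟩ := List.eq_nil_or_concat x |>.resolve_left hx
  rw [List.concat_eq_append]
  have := prepend u (AlignCost.single a b)
  convert this using 1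
  rw [List.countP_append, List.countP_singleton]
  by_cases hab : a = b <;> simp [symbolDist, hab]

theorem replicate (a : S) {p q : ℕ} (hp : 0 < p) (hq : 0 < q) :
    AlignCost (List.replicate p a) (List.replicate q a) 0 := by
  obtain ⟨p, rfl⟩ := Nat.exists_eq_succ_of_ne_zero hp.ne'
  obtain ⟨q, rfl⟩ := Nat.exists_eq_succ_of_ne_zero hq.ne'
  have h₁ : AlignCost (List.replicate (q + 1) a) [a] 0 := by
    convert singleton (List.replicate (q + 1) a) a (by simp) using 1
    simp [List.countP_replicate]
  have h₂ := prepend (List.replicate p a) h₁.symm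
  rw [← List.replicate_succ' (n := p)] at h₂
  simpa [List.countP_replicate, ← List.replicate_succ] using h₂

/-- Symbols of the first list that do not occur in the second list all cost something. -/
theorem countP_notMem_le {x y : List S} {k : ℕ} (h : AlignCost x y k) :
    x.countP (· ∉ y) ≤ k := by
  suffices H : ∀ l : List S, (∀ b ∈ y, b ∈ l) → x.countP (· ∉ l) ≤ k from H y fun _ => id
  intro l
  have key : ∀ {a b : S}, b ∈ l → (if a ∉ l then 1 else 0) ≤ symbolDist a b := by
    intro a b hb
    by_cases ha : a ∈ l
    · simp [ha]
    · rw [symbolDist_of_ne]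
      · simp [ha]
      · rintro rfl; exact ha hb
  induction h with
  | single a b =>
    intro hl
    have := key (a := a) (hl b (by simp))
    simpa [List.countP_cons] using this
  | left a b _ ih =>
    intro hl
    have := key (a := a) (hl b (by simp))
    have := ih hl
    simp only [List.countP_cons, decide_eq_true_eq]; omega
  | right a b _ ih =>
    intro hl
    exact (ih fun b hb => hl b (by simp [hb])).trans (by omega)
  | diag a b _ ih =>
    intro hl
    have := key (a := a) (hl b (by simp))
    have := ih fun b hb => hl b (by simp [hb])
    simp only [List.countP_cons, decide_eq_true_eq]; omega

/-- The cost of a traversal, distributed over the symbols of the first list: a symbol that gets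
no cost is at some time aligned with an equal symbol, and the traversal up to that time costs no
more than the whole one. -/
theorem exists_rowCost {x y : List S} {k : ℕ} (h : AlignCost x y k) :
    ∃ c : ℕ → ℕ, ∑ i ∈ Finset.range x.length, c i = k ∧
      ∀ u e v, x = u ++ e :: v → c u.length = 0 →
        ∃ u' v', y = u' ++ e :: v' ∧ ∃ k' ≤ k, AlignCost (u ++ [e]) (u' ++ [e]) k' := by
  induction h with
  | single a b =>
    refine ⟨fun _ => symbolDist a b, by simp, ?_⟩
    intro u e v hx hc
    obtain rfl := symbolDist_eq_zero.1 hc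
    cases u with
    | cons _ u => simp at hx
    | nil =>
      obtain ⟨rfl, rfl⟩ : a = e ∧ v = [] := by simpa [eq_comm] using hx
      exact ⟨[], [], rfl, _, le_rfl, .single a a⟩
  | @left a b x y k h ih =>
    obtain ⟨c, hc, H⟩ := ih
    refine ⟨fun i => i.casesOn (symbolDist a b) c, ?_, ?_⟩
    · rw [List.length_cons, Finset.sum_range_succ', ← hc, add_comm]
      rfl
    intro u e v hx h0
    cases u with
    | nil =>
      obtain ⟨rfl, rfl⟩ : a = e ∧ x = v := by simpa using hx
      obtain rfl := symbolDist_eq_zero.1 h0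
      exact ⟨[], y, rfl, _, Nat.le_add_right _ _, .single a a⟩
    | cons a' u =>
      obtain ⟨rfl, rfl⟩ : a = a' ∧ x = u ++ e :: v := by simpa using hx
      obtain ⟨u', v', hy, k', hk, h'⟩ := H u e v rfl h0
      refine ⟨u', v', hy, symbolDist a b + k', by omega, ?_⟩
      cases u' with
      | nil =>
        obtain ⟨rfl, rfl⟩ : b = e ∧ y = v' := by simpa using hy
        exact .left a b h'
      | cons b' u' =>
        obtain ⟨rfl, rfl⟩ : b = b' ∧ y = u' ++ e :: v' := by simpa using hy
        exact .left a b h'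
  | @right a b x y k h ih =>
    obtain ⟨c, hc, H⟩ := ih
    refine ⟨fun i => i.casesOn (symbolDist a b + c 0) (fun i => c (i + 1)), ?_, ?_⟩
    · rw [List.length_cons, Finset.sum_range_succ'] at hc ⊢
      rw [← hc]
      change ∑ i ∈ Finset.range x.length, c (i + 1) + (symbolDist a b + c 0) = _
      omega
    intro u e v hx h0
    have h0' : c u.length = 0 := by
      cases u with
      | nil => exact (Nat.add_eq_zero_iff.1 h0).2
      | cons _ u => exact h0
    obtain ⟨u', v', rfl, k', hk, h'⟩ := H u e v hx h0'
    refine ⟨b :: u', v', rfl, symbolDist a b + k', by omega, ?_⟩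
    cases u with
    | nil =>
      obtain ⟨rfl, rfl⟩ : a = e ∧ x = v := by simpa using hx
      exact .right a b h'
    | cons a' u =>
      obtain ⟨rfl, rfl⟩ : a = a' ∧ x = u ++ e :: v := by simpa using hx
      exact .right a b h'
  | @diag a b x y k h ih =>
    obtain ⟨c, hc, H⟩ := ih
    refine ⟨fun i => i.casesOn (symbolDist a b) c, ?_, ?_⟩
    · rw [List.length_cons, Finset.sum_range_succ', ← hc, add_comm]
      rfl
    intro u e v hx h0
    cases u with
    | nil =>
      obtain ⟨rfl, rfl⟩ : a = e ∧ x = v := by simpa using hx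
      obtain rfl := symbolDist_eq_zero.1 h0
      exact ⟨[], y, rfl, _, Nat.le_add_right _ _, .single a a⟩
    | cons a' u =>
      obtain ⟨rfl, rfl⟩ : a = a' ∧ x = u ++ e :: v := by simpa using hx
      obtain ⟨u', v', rfl, k', hk, h'⟩ := H u e v rfl h0
      exact ⟨b :: u', v', rfl, symbolDist a b + k', by omega, .diag a b h'⟩

/-- Deleting a first symbol that is never matched does not increase the cost. -/
theorem drop_head {c : S} {x y : List S} {k : ℕ} (h : AlignCost (c :: x) y k) (hx : x ≠ [])
    (hc : c ∉ y) : ∃ k' ≤ k, AlignCost x y k' := by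
  generalize hz : c :: x = z at h
  induction h with
  | single a b => simp_all
  | left a b h =>
    obtain ⟨rfl, rfl⟩ := List.cons_eq_cons.1 hz
    exact ⟨_, Nat.le_add_left _ _, h⟩
  | right a b h ih =>
    obtain ⟨k', hk, h'⟩ := ih (fun h => hc (by simp [h])) hz
    obtain ⟨rfl, rfl⟩ := List.cons_eq_cons.1 hz
    obtain ⟨e, x, rfl⟩ := List.exists_cons_of_ne_nil hx
    refine ⟨_, ?_, .right e b h'⟩
    have : c ≠ b := by rintro rfl; simp at hc
    have := symbolDist_le_one e b
    rw [symbolDist_of_ne ‹c ≠ b›]; omega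
  | diag a b h =>
    obtain ⟨rfl, rfl⟩ := List.cons_eq_cons.1 hz
    obtain ⟨e, x, rfl⟩ := List.exists_cons_of_ne_nil hx
    refine ⟨_, ?_, .right e b h⟩
    have : c ≠ b := by rintro rfl; simp at hc
    have := symbolDist_le_one e b
    rw [symbolDist_of_ne ‹c ≠ b›]; omega

/-- Deleting a last symbol that is never matched does not increase the cost. -/
theorem drop_last {c : S} {x y : List S} {k : ℕ} (h : AlignCost (x ++ [c]) y k) (hx : x ≠ [])
    (hc : c ∉ y) : ∃ k' ≤ k, AlignCost x y k' := by
  have key : ∀ (a b : S) (y : List S) (k : ℕ), AlignCost [c] y k → c ∉ y →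
      ∃ k' ≤ symbolDist a b + k, AlignCost [a] (b :: y) k' := by
    intro a b y k h hc
    refine ⟨_, ?_, .right a b (singleton y a h.right_ne_nil).symm⟩
    have h₁ := h.symm.countP_notMem_le
    have h₂ : y.countP (fun e => decide (e ∉ [c])) = y.length := by
      rw [List.countP_eq_length]
      intro e he
      simp only [List.mem_singleton, decide_eq_true_eq]
      rintro rfl
      exact hc he
    have h₃ := List.countP_le_length (p := fun e => decide (e ≠ a)) (l := y)
    omega
  generalize hz : x ++ [c] = z at h
  induction h generalizing x with
  | single a b =>
    obtain ⟨e, x, rfl⟩ := List.exists_cons_of_ne_nil hx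
    simp at hz
  | left a b h ih =>
    obtain ⟨e, x, rfl⟩ := List.exists_cons_of_ne_nil hx
    obtain ⟨rfl, rfl⟩ := List.cons_eq_cons.1 hz
    rcases eq_or_ne x [] with rfl | hx
    · have h₁ := h.symm
      cases h with
      | single =>
        exact ⟨_, Nat.le_add_right _ _, .single e b⟩
      | right _ _ h =>
        obtain ⟨k', hk, h'⟩ := key e b _ _ h (fun h => hc (by simp [h]))
        exact ⟨k', by omega, h'⟩
      | left _ _ h => exact absurd rfl h.left_ne_nil
      | diag _ _ h => exact absurd rfl h.left_ne_nil
    · obtain ⟨k', hk, h'⟩ := ih hx hc rfl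
      exact ⟨_, by omega, .left e b h'⟩
  | right a b h ih =>
    obtain ⟨e, x, rfl⟩ := List.exists_cons_of_ne_nil hx
    obtain ⟨k', hk, h'⟩ := ih hx (fun h => hc (by simp [h])) hz
    obtain ⟨rfl, rfl⟩ := List.cons_eq_cons.1 hz
    exact ⟨_, by omega, .right e b h'⟩
  | diag a b h ih =>
    obtain ⟨e, x, rfl⟩ := List.exists_cons_of_ne_nil hx
    obtain ⟨rfl, rfl⟩ := List.cons_eq_cons.1 hz
    rcases eq_or_ne x [] with rfl | hx
    · exact key e b _ _ h (fun h => hc (by simp [h]))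
    · obtain ⟨k', hk, h'⟩ := ih hx (fun h => hc (by simp [h])) rfl
      exact ⟨_, by omega, .diag e b h'⟩

theorem cons_left {x y : List S} {k : ℕ} (a : S) (h : AlignCost x y k) :
    ∃ k' ≤ k + 1, AlignCost (a :: x) y k' := by
  obtain ⟨b, y, rfl⟩ := List.exists_cons_of_ne_nil h.right_ne_nil
  have := symbolDist_le_one a b
  exact ⟨_, by omega, .left a b h⟩

theorem concat_left {x y : List S} {k : ℕ} (a : S) (h : AlignCost x y k) :
    ∃ k' ≤ k + 1, AlignCost (x ++ [a]) y k' := by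
  induction h with
  | single e b =>
    have := symbolDist_le_one a b
    exact ⟨_, by omega, .left e b (.single a b)⟩
  | left e b _ ih =>
    obtain ⟨k', hk, h'⟩ := ih
    exact ⟨_, by omega, .left e b h'⟩
  | right e b _ ih =>
    obtain ⟨k', hk, h'⟩ := ih
    exact ⟨_, by omega, .right e b h'⟩
  | diag e b _ ih =>
    obtain ⟨k', hk, h'⟩ := ih
    exact ⟨_, by omega, .diag e b h'⟩

/-- Completing `s` to `u ++ s ++ v`, after stripping unmatched symbols `c` around it, costs at
most one for each new symbol. -/
theorem complete_infix {c : S} {p q : ℕ} {s y u v : List S} {k : ℕ}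
    (h : AlignCost (List.replicate p c ++ s ++ List.replicate q c) y k) (hs : s ≠ [])
    (hc : c ∉ y) : ∃ k' ≤ k + u.length + v.length, AlignCost (u ++ s ++ v) y k' := by
  have h₁ : ∃ k' ≤ k, AlignCost (s ++ List.replicate q c) y k' := by
    induction p generalizing k with
    | zero => exact ⟨k, le_rfl, by simpa using h⟩
    | succ p ih =>
      rw [List.replicate_succ, List.cons_append, List.cons_append] at h
      obtain ⟨k', hk, h'⟩ := h.drop_head (by simp [hs]) hc
      obtain ⟨k'', hk', h''⟩ := ih h'
      exact ⟨k'', by omega, h''⟩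
  obtain ⟨k₁, hk₁, h₁⟩ := h₁
  have h₂ : ∃ k' ≤ k₁, AlignCost s y k' := by
    clear hk₁ h
    induction q generalizing k₁ with
    | zero => exact ⟨k₁, le_rfl, by simpa using h₁⟩
    | succ q ih =>
      rw [List.replicate_succ', ← List.append_assoc] at h₁
      obtain ⟨k', hk, h'⟩ := h₁.drop_last (by simp [hs]) hc
      obtain ⟨k'', hk', h''⟩ := ih k' h'
      exact ⟨k'', by omega, h''⟩
  obtain ⟨k₂, hk₂, h₂⟩ := h₂
  have h₃ : ∃ k' ≤ k₂ + u.length, AlignCost (u ++ s) y k' := by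
    induction u with
    | nil => exact ⟨k₂, le_rfl, by simpa using h₂⟩
    | cons a u ih =>
      obtain ⟨k', hk, h'⟩ := ih
      obtain ⟨k'', hk', h''⟩ := h'.cons_left a
      exact ⟨k'', by simp only [List.length_cons]; omega, h''⟩
  obtain ⟨k₃, hk₃, h₃⟩ := h₃
  have h₄ : ∃ k' ≤ k₃ + v.length, AlignCost (u ++ s ++ v) y k' := by
    induction v using List.reverseRecOn with
    | nil => exact ⟨k₃, le_rfl, by simpa using h₃⟩
    | append_singleton v a ih =>
      obtain ⟨k', hk, h'⟩ := ih
      obtain ⟨k'', hk', h''⟩ := h'.concat_left a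
      exact ⟨k'', by simp only [List.length_append, List.length_singleton]; omega,
        by simpa using h''⟩
  obtain ⟨k₄, hk₄, h₄⟩ := h₄
  exact ⟨k₄, by omega, h₄⟩

end AlignCost

/-! ### Long runs as separators -/

/-- The list `x` contains, one after another, runs of length `K` of the symbols of `R`. -/
def HasRuns {S : Type*} (K : ℕ) : List S → List S → Prop
  | [], _ => True
  | c :: R, x => ∃ u v, x = u ++ List.replicate K c ++ v ∧ HasRuns K R v

theorem HasRuns.append_left {S : Type*} {K : ℕ} {R x : List S} (u : List S) (h : HasRuns K R x) :
    HasRuns K R (u ++ x) := by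
  cases R with
  | nil => trivial
  | cons c R =>
    obtain ⟨u', v, rfl, hv⟩ := h
    exact ⟨u ++ u', v, by simp, hv⟩

/-- In a traversal that costs less than `K`, each run of length `K` is matched at least once, so
the symbols of successive runs form a subsequence of the other list. -/
theorem AlignCost.sublist_of_hasRuns {S : Type*} [DecidableEq S] {K : ℕ} (hK : 0 < K)
    {R x y : List S} {k : ℕ} (h : AlignCost x y k) (hk : k < K) (hR : R.IsChain (· ≠ ·))
    (hx : HasRuns K R x) :
    R.Sublist y := by
  -- a part of `y` aligned with a whole run contains the symbol of the run
  have mem : ∀ (c : S) (y : List S) (k : ℕ), AlignCost (List.replicate K c) y k → k < K →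
      c ∈ y := by
    intro c y k h hk
    by_contra hc
    have := h.countP_notMem_le
    simp [List.countP_replicate, hc] at this
    omega
  have split_left : ∀ {x₁ x₂ y : List S} {k : ℕ}, AlignCost (x₁ ++ x₂) y k → x₁ ≠ [] →
      x₂ ≠ [] → k < K → ∃ y₁ y₂ k₁ k₂, k₁ < K ∧ k₂ < K ∧ AlignCost x₁ y₁ k₁ ∧
        AlignCost x₂ y₂ k₂ ∧ (y = y₁ ++ y₂ ∨ ∃ u c v, y = u ++ c :: v ∧ y₁ = u ++ [c] ∧
          y₂ = c :: v) := by
    intro x₁ x₂ y k h h₁ h₂ hk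
    obtain ⟨k₁, k₂, hk', ⟨y₁, y₂, rfl, ha, hb⟩ | ⟨u, c, v, rfl, ha, hb⟩⟩ :=
      h.symm.split_right h₁ h₂
    · exact ⟨y₁, y₂, k₁, k₂, by omega, by omega, ha.symm, hb.symm, .inl rfl⟩
    · exact ⟨_, _, k₁, k₂, by omega, by omega, ha.symm, hb.symm, .inr ⟨u, c, v, rfl, rfl, rfl⟩⟩
  induction R generalizing x y k with
  | nil => exact List.nil_sublist _
  | cons c R ih =>
    obtain ⟨u, v, rfl, hv⟩ := hx
    have hrep : List.replicate K c ≠ [] := by simp; omega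
    -- drop what precedes the run
    obtain ⟨y', k', hk', h', hy'⟩ : ∃ y' k', k' < K ∧ AlignCost (List.replicate K c ++ v) y' k' ∧
        y'.Sublist y := by
      rcases eq_or_ne u [] with rfl | hu
      · exact ⟨y, k, hk, by simpa using h, List.Sublist.refl _⟩
      rw [List.append_assoc] at h
      obtain ⟨y₁, y₂, k₁, k₂, -, hk₂, -, h₂, rfl | ⟨u', e, v', rfl, -, rfl⟩⟩ :=
        split_left h hu (by simp [hrep]) hk
      · exact ⟨y₂, k₂, hk₂, h₂, List.sublist_append_right _ _⟩
      · exact ⟨_, k₂, hk₂, h₂, List.sublist_append_right _ _⟩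
    refine List.Sublist.trans ?_ hy'
    rcases eq_or_ne v [] with rfl | hvne
    · have hRnil : R = [] := by
        cases R with
        | nil => rfl
        | cons e R =>
          obtain ⟨u', v', he, -⟩ := hv
          have := congrArg List.length he
          simp at this; omega
      subst hRnil
      exact List.singleton_sublist.2 (mem c y' k' (by simpa using h') hk')
    have hR' : R.IsChain (· ≠ ·) := hR.tail
    obtain ⟨y₁, y₂, k₁, k₂, hk₁, hk₂, h₁, h₂, hy⟩ := split_left h' hrep hvne hk'
    have hc := List.singleton_sublist.2 (mem c y₁ k₁ h₁ hk₁)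
    have hsub := ih h₂ hk₂ hR' hv
    rcases hy with rfl | ⟨u', e, v', rfl, rfl, rfl⟩
    · exact hc.append hsub
    · rcases eq_or_ne c e with rfl | hce
      · -- the shared symbol is `c`, which the next run cannot use
        have : R.Sublist v' := by
          cases R with
          | nil => exact List.nil_sublist _
          | cons e R =>
            have hne : c ≠ e := (List.isChain_cons_cons.1 hR).1
            cases hsub with
            | cons _ h => exact h
            | cons_cons _ h => exact absurd rfl hne
        exact (this.cons_cons c).trans (List.sublist_append_right _ _)
      · have hc' : [c].Sublist u' := by
          rw [List.singleton_sublist] at hc ⊢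
          simpa [hce] using hc
        exact hc'.append hsub

theorem List.Sublist.of_append_of_notMem {S : Type*} {c : S} {R u v : List S}
    (h : (c :: R).Sublist (u ++ v))
    (hc : c ∉ u) : (c :: R).Sublist v := by
  induction u with
  | nil => exact h
  | cons a u ih =>
    simp only [List.mem_cons, not_or] at hc
    cases h with
    | cons _ h => exact ih h hc.2
    | cons_cons _ h => exact absurd rfl hc.1

/-- The word `a b a b … a` with `h` occurrences of `b`. -/
def alternating {S : Type*} (a b : S) : ℕ → List S
  | 0 => [a]
  | h + 1 => a :: b :: alternating a b h

theorem exists_alternating_eq_cons {S : Type*} (a b : S) (h : ℕ) :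
    ∃ l, alternating a b h = a :: l := by
  cases h <;> exact ⟨_, rfl⟩

theorem isChain_alternating {S : Type*} {a b : S} (hab : a ≠ b) (h : ℕ) :
    (alternating a b h).IsChain (· ≠ ·) := by
  induction h with
  | zero => simp [alternating]
  | succ h ih =>
    obtain ⟨l, hl⟩ := exists_alternating_eq_cons a b h
    simp only [alternating]
    rw [hl] at ih ⊢
    exact .cons_cons hab (.cons_cons hab.symm ih)

/-- A concatenation of `g` blocks, in each of which all `a` precede all `b`, followed by a list
without `b`, has no alternating subsequence with more than `g` occurrences of `b`. -/
theorem le_length_of_alternating_sublist {S : Type*} {a b : S} {h : ℕ} {l : List (List S × List S)}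
    {z : List S} (hl : ∀ p ∈ l, b ∉ p.1 ∧ a ∉ p.2) (hz : b ∉ z)
    (hs : (alternating a b h).Sublist (l.flatMap (fun p => p.1 ++ p.2) ++ z)) : h ≤ l.length := by
  induction l generalizing h with
  | nil =>
    cases h with
    | zero => simp
    | succ h => exact absurd (hs.subset (show b ∈ _ by simp [alternating])) (by simpa using hz)
  | cons p l ih =>
    cases h with
    | zero => simp
    | succ h =>
      obtain ⟨h₁, h₂⟩ := hl p (by simp)
      rw [List.flatMap_cons, List.append_assoc, List.append_assoc] at hs
      have h₃ := ((List.sublist_cons_self _ _).trans hs).of_append_of_notMem h₁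
      have h₄ := (List.sublist_cons_self _ _).trans h₃
      obtain ⟨l', hl'⟩ := exists_alternating_eq_cons a b h
      rw [hl'] at h₄
      have h₅ := h₄.of_append_of_notMem h₂
      rw [← hl'] at h₅
      have := ih (fun p hp => hl p (by simp [hp])) h₅
      simp; omega

/-! ### Vector gadgets -/

/-- The block of a coordinate of a vector of the first list. Between runs of `2` and of `3`
stand `21` for the coordinate `0` and `01` for the coordinate `1`. -/
def leftBlock (K : ℕ) (a : Bool) : List (Fin 5) :=
  List.replicate K 2 ++ (bif a then 0 else 2) :: 1 :: List.replicate K 3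

/-- The block of a coordinate of a vector of the second list. Between runs of `2` and of `3`
stands `0` for the coordinate `0` and `2`, which only prolongs a run, for the coordinate `1`. -/
def rightBlock (K : ℕ) (b : Bool) : List (Fin 5) :=
  List.replicate K 2 ++ (bif b then 2 else 0) :: List.replicate (K + 1) 3

/-- The gadget of the vector `a 0, …, a (m - 1)` of the first list. -/
def leftGadget (K m : ℕ) (a : ℕ → Bool) : List (Fin 5) :=
  (List.range m).flatMap fun h => leftBlock K (a h)

/-- The gadget of the vector `b 0, …, b (m - 1)` of the second list. -/
def rightGadget (K m : ℕ) (b : ℕ → Bool) : List (Fin 5) :=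
  (List.range m).flatMap fun h => rightBlock K (b h)

/-- The inner product of two vectors of `m` bits. -/
def bitInner (m : ℕ) (a b : ℕ → Bool) : ℕ := ∑ h ∈ Finset.range m, (a h && b h).toNat

theorem length_leftBlock (K : ℕ) (a : Bool) : (leftBlock K a).length = 2 * K + 2 := by
  simp [leftBlock]; omega

theorem length_rightBlock (K : ℕ) (b : Bool) : (rightBlock K b).length = 2 * K + 2 := by
  simp [rightBlock]; omega

theorem leftGadget_succ (K m : ℕ) (a : ℕ → Bool) :
    leftGadget K (m + 1) a = leftGadget K m a ++ leftBlock K (a m) := by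
  simp [leftGadget, List.range_succ]

theorem rightGadget_succ (K m : ℕ) (b : ℕ → Bool) :
    rightGadget K (m + 1) b = rightGadget K m b ++ rightBlock K (b m) := by
  simp [rightGadget, List.range_succ]

theorem length_leftGadget (K m : ℕ) (a : ℕ → Bool) :
    (leftGadget K m a).length = m * (2 * K + 2) := by
  induction m with
  | zero => simp [leftGadget]
  | succ m ih => rw [leftGadget_succ, List.length_append, ih, length_leftBlock]; ring

theorem length_rightGadget (K m : ℕ) (b : ℕ → Bool) :
    (rightGadget K m b).length = m * (2 * K + 2) := by
  induction m with
  | zero => simp [rightGadget]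
  | succ m ih => rw [rightGadget_succ, List.length_append, ih, length_rightBlock]; ring

theorem four_notMem_leftGadget (K m : ℕ) (a : ℕ → Bool) : 4 ∉ leftGadget K m a := by
  simp only [leftGadget, leftBlock, List.mem_flatMap, not_exists]
  intro h
  cases a h <;> simp [List.mem_replicate]

theorem four_notMem_rightGadget (K m : ℕ) (b : ℕ → Bool) : 4 ∉ rightGadget K m b := by
  simp only [rightGadget, rightBlock, List.mem_flatMap, not_exists]
  intro h
  cases b h <;> simp [List.mem_replicate]

theorem one_notMem_rightGadget (K m : ℕ) (b : ℕ → Bool) : 1 ∉ rightGadget K m b := by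
  simp only [rightGadget, rightBlock, List.mem_flatMap, not_exists]
  intro h
  cases b h <;> simp [List.mem_replicate]

/-- If both coordinates are `0`, the symbol `2` of the first block is absorbed by the run of `2`,
and `1` meets `0`. Otherwise the two middle symbols of the blocks are aligned one by one: the first
pair matches unless both coordinates are `1`, and the second pair, `1` and `3`, never does. -/
theorem alignCost_blocks {K : ℕ} (hK : 0 < K) (a b : Bool) :
    AlignCost (leftBlock K a) (rightBlock K b) (1 + (a && b).toNat) := by
  have h₂ : ∀ p q, AlignCost (List.replicate (K + p) (2 : Fin 5)) (List.replicate (K + q) 2) 0 :=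
    fun p q => .replicate 2 (by omega) (by omega)
  have h₃ : ∀ p q, AlignCost (List.replicate (K + p) (3 : Fin 5)) (List.replicate (K + q) 3) 0 :=
    fun p q => .replicate 3 (by omega) (by omega)
  by_cases hab : a = false ∧ b = false
  · obtain ⟨rfl, rfl⟩ := hab
    have := ((h₂ 1 0).append (.single 1 0)).append (h₃ 0 1)
    simpa [leftBlock, rightBlock, List.replicate_succ', List.append_assoc, symbolDist] using this
  · have := (h₂ 0 0).append (.diag (bif a then 0 else 2) (bif b then 2 else 0)
      (.diag 1 3 (h₃ 0 0)))
    have hcost : 0 + (symbolDist (bif a then (0 : Fin 5) else 2) (bif b then 2 else 0) +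
        (symbolDist (1 : Fin 5) 3 + 0)) = 1 + (a && b).toNat := by
      cases a <;> cases b <;> simp [symbolDist] at hab ⊢
    rw [hcost] at this
    exact this

theorem alignCost_gadgets {K m : ℕ} (hK : 0 < K) (hm : 0 < m) (a b : ℕ → Bool) :
    AlignCost (leftGadget K m a) (rightGadget K m b) (m + bitInner m a b) := by
  induction m with
  | zero => omega
  | succ m ih =>
    have hb := alignCost_blocks hK (a m) (b m)
    rw [leftGadget_succ, rightGadget_succ]
    rcases Nat.eq_zero_or_pos m with rfl | hm'
    · simpa [leftGadget, rightGadget, bitInner] using hb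
    · convert (ih hm').append hb using 1
      rw [bitInner, bitInner, Finset.sum_range_succ]; ring

/-- The runs of `2` and `3` in a prefix that ends between the two runs of a block. -/
theorem hasRuns_alternating {K h : ℕ} {f : ℕ → List (Fin 5)} (z : List (Fin 5))
    (hf : ∀ i, ∃ u v, f i = List.replicate K 2 ++ u ++ List.replicate K 3 ++ v) :
    HasRuns K (alternating 2 3 h)
      ((List.range h).flatMap f ++ (List.replicate K 2 ++ z)) := by
  induction h generalizing f with
  | zero => exact ⟨[], z, by simp, trivial⟩
  | succ h ih =>
    obtain ⟨u, v, huv⟩ := hf 0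
    have hrest := (ih (f := fun i => f (i + 1)) fun i => hf (i + 1)).append_left v
    refine ⟨[], u ++ List.replicate K 3 ++ v ++ ((List.range h).flatMap (fun i => f (i + 1)) ++
      (List.replicate K 2 ++ z)), ?_, u, v ++ ((List.range h).flatMap (fun i => f (i + 1)) ++
      (List.replicate K 2 ++ z)), by simp, hrest⟩
    rw [List.range_succ_eq_map, List.flatMap_cons, List.flatMap_map, huv]
    simp

/-- In a prefix of a traversal that costs less than `K`, the prefix of the second list has at
least as many blocks as that of the first one. -/
theorem AlignCost.block_le {K g h k : ℕ} {f f' : ℕ → List (Fin 5)} {c : Fin 5} (hc : c ≠ 3)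
    (hf : ∀ i, ∃ u v, f i = List.replicate K 2 ++ u ++ List.replicate K 3 ++ v)
    (hf' : ∀ i, ∃ u v, f' i = u ++ v ∧ 3 ∉ u ∧ 2 ∉ v)
    (H : AlignCost ((List.range h).flatMap f ++ (List.replicate K 2 ++ [c]))
      ((List.range g).flatMap f' ++ (List.replicate K 2 ++ [c])) k) (hk : k < K) : h ≤ g := by
  have hs := H.sublist_of_hasRuns (by omega) hk (isChain_alternating (by decide) h)
    (hasRuns_alternating [c] hf)
  choose u v huv hu hv using hf'
  have := le_length_of_alternating_sublist (l := (List.range g).map fun i => (u i, v i))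
    (z := List.replicate K 2 ++ [c]) (a := 2) (b := 3) (h := h) (by simp [hu, hv])
    (by simp [List.mem_replicate, hc.symm])
    (by simpa only [List.flatMap_map, ← huv] using hs)
  simpa using this

theorem eq_of_rightBlock_eq {K : ℕ} {b : Bool} {u v : List (Fin 5)}
    (h : rightBlock K b = u ++ 0 :: v) : b = false ∧ u = List.replicate K 2 := by
  have hb : b = false := by
    have : (0 : Fin 5) ∈ rightBlock K b := by rw [h]; simp
    cases b
    · rfl
    · simp [rightBlock, List.mem_replicate] at this
  refine ⟨hb, ?_⟩
  rw [hb, rightBlock, List.append_eq_append_iff] at h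
  rcases h with ⟨w, rfl, hw⟩ | ⟨w, hw, hw'⟩
  · cases w with
    | nil => simp
    | cons e w =>
      have : (0 : Fin 5) ∈ List.replicate (K + 1) (3 : Fin 5) := by
        rw [(List.cons_eq_cons.1 hw).2]; simp
      simp [List.mem_replicate] at this
  · cases w with
    | nil => rw [hw, List.append_nil]
    | cons e w =>
      have he : (0 : Fin 5) = e := (List.cons_eq_cons.1 hw').1
      have : e ∈ List.replicate K (2 : Fin 5) := by rw [hw]; simp
      simp [← he, List.mem_replicate] at this

theorem exists_eq_of_rightGadget_eq {K m : ℕ} {b : ℕ → Bool} {u v : List (Fin 5)}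
    (h : rightGadget K m b = u ++ 0 :: v) : ∃ g < m, b g = false ∧
      u = (List.range g).flatMap (fun i => rightBlock K (b i)) ++ List.replicate K 2 := by
  induction m generalizing v with
  | zero => simp [rightGadget] at h
  | succ m ih =>
    rw [rightGadget_succ, List.append_eq_append_iff] at h
    rcases h with ⟨w, rfl, hw⟩ | ⟨w, hu, hw⟩
    · obtain ⟨hb, rfl⟩ := eq_of_rightBlock_eq hw
      exact ⟨m, by omega, hb, rfl⟩
    · cases w with
      | nil =>
        obtain ⟨hb, hK⟩ := eq_of_rightBlock_eq (u := []) hw.symm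
        exact ⟨m, by omega, hb, by rw [← hK, List.append_nil]; simpa [rightGadget] using hu.symm⟩
      | cons e w =>
        obtain ⟨rfl, rfl⟩ : 0 = e ∧ v = w ++ rightBlock K (b m) := by simpa using hw
        obtain ⟨g, hg, h'⟩ := ih hu
        exact ⟨g, by omega, h'⟩

theorem sum_two_le_sum_range (c : ℕ → ℕ) (K m : ℕ) :
    ∑ h ∈ Finset.range m, (c (h * (2 * K + 2) + K) + c (h * (2 * K + 2) + K + 1)) ≤
      ∑ i ∈ Finset.range (m * (2 * K + 2)), c i := by
  induction m with
  | zero => simp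
  | succ m ih =>
    rw [Finset.sum_range_succ, add_mul, one_mul, Finset.sum_range_add]
    refine add_le_add ih ?_
    have : ({K, K + 1} : Finset ℕ) ⊆ Finset.range (2 * K + 2) := by
      intro i hi
      simp only [Finset.mem_insert, Finset.mem_singleton] at hi
      simp only [Finset.mem_range]; omega
    calc _ = ∑ i ∈ {K, K + 1}, c (m * (2 * K + 2) + i) := by
            rw [Finset.sum_pair (by omega)]; rfl
      _ ≤ _ := Finset.sum_le_sum_of_subset this

theorem exists_range_eq_append {h m : ℕ} (hm : h < m) :
    ∃ l, List.range m = List.range h ++ h :: l := by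
  obtain ⟨t, rfl⟩ := Nat.exists_eq_add_of_lt hm
  refine ⟨((List.range t).map (· + 1)).map (h + ·), ?_⟩
  rw [add_assoc, List.range_add, List.range_succ_eq_map]
  simp

/-- Two gadgets of `m` coordinates cost at least `m` plus the inner product, or else at least
`K`: the symbol `1` of each block of the first gadget is never matched, and if two coordinates at
the same position are both `1`, then the symbol `0` of the first block could only be matched in
another block, which misaligns the runs. -/
theorem AlignCost.le_of_gadgets {K m k : ℕ} {a b : ℕ → Bool}
    (H : AlignCost (leftGadget K m a) (rightGadget K m b) k) :
    min K (m + bitInner m a b) ≤ k := by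
  by_contra! hlt
  have hkK : k < K := lt_of_lt_of_le hlt (min_le_left _ _)
  obtain ⟨c, hc, hmatch⟩ := H.exists_rowCost
  rw [length_leftGadget] at hc
  refine absurd ?_ (not_le.2 (lt_of_lt_of_le hlt (min_le_right _ _)))
  refine le_trans ?_ (hc ▸ sum_two_le_sum_range c K m)
  have hm : m + bitInner m a b = ∑ h ∈ Finset.range m, ((a h && b h).toNat + 1) := by
    rw [Finset.sum_add_distrib]; simp [bitInner, add_comm]
  rw [hm]
  refine Finset.sum_le_sum fun h hh => ?_
  obtain ⟨l, hl⟩ := exists_range_eq_append (Finset.mem_range.1 hh)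
  have hlen : ((List.range h).flatMap (fun i => leftBlock K (a i)) ++
      List.replicate K 2).length = h * (2 * K + 2) + K := by
    have := length_leftGadget K h a
    rw [leftGadget] at this
    rw [List.length_append, this, List.length_replicate]
  have hx : leftGadget K m a = ((List.range h).flatMap (fun i => leftBlock K (a i)) ++
      List.replicate K 2) ++ (bif a h then 0 else 2) :: 1 :: (List.replicate K 3 ++
        l.flatMap fun i => leftBlock K (a i)) := by
    simp [leftGadget, hl, leftBlock]
  refine add_le_add ?_ ?_
  · -- if both coordinates are `1`, the symbol `0` of the block costs something
    cases ha : a h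
    · simp
    cases hb : b h
    · simp
    simp only [Bool.and_self, Bool.toNat_true, Nat.one_le_iff_ne_zero]
    intro h0
    rw [ha] at hx
    obtain ⟨u', v', hy, k', hk', h'⟩ := hmatch _ _ _ hx (by rw [hlen]; exact h0)
    obtain ⟨g, -, hbg, rfl⟩ := exists_eq_of_rightGadget_eq hy
    -- the block of the matched symbol is the same one by the runs before it, in both directions
    have hgh : g = h := by
      rw [List.append_assoc, List.append_assoc] at h'
      refine le_antisymm (h'.symm.block_le (by decide) ?_ ?_ (by omega))
        (h'.block_le (by decide) ?_ ?_ (by omega))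
      · intro i
        exact ⟨[bif b i then 2 else 0], [3], by simp [rightBlock, List.replicate_succ']⟩
      · intro i
        refine ⟨List.replicate K 2 ++ [bif a i then 0 else 2, 1], List.replicate K 3,
          by simp [leftBlock], ?_, by simp [List.mem_replicate]⟩
        cases a i <;> simp [List.mem_replicate]
      · intro i
        exact ⟨[bif a i then 0 else 2, 1], [], by simp [leftBlock]⟩
      · intro i
        refine ⟨List.replicate K 2 ++ [bif b i then 2 else 0], List.replicate (K + 1) 3,
          by simp [rightBlock], ?_, by simp [List.mem_replicate]⟩
        cases b i <;> simp [List.mem_replicate]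
    rw [hgh, hb] at hbg
    exact absurd hbg (by simp)
  · -- the symbol `1` always costs something
    rw [Nat.one_le_iff_ne_zero]
    intro h0
    obtain ⟨u', v', hy, -⟩ := hmatch (((List.range h).flatMap (fun i => leftBlock K (a i)) ++
      List.replicate K 2) ++ [bif a h then 0 else 2]) 1 _ (by rw [hx, List.append_cons])
      (by rw [List.length_append, hlen]; exact h0)
    exact one_notMem_rightGadget K m b (by rw [hy]; simp)

/-! ### Alignment of lists of gadgets -/

/-- The gadgets of a list, each preceded by a separator, a run of `M` symbols `4`. -/
def separated (M : ℕ) (l : List (List (Fin 5))) : List (Fin 5) :=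
  l.flatMap fun A => List.replicate M 4 ++ A

theorem separated_cons (M : ℕ) (A : List (Fin 5)) (l : List (List (Fin 5))) :
    separated M (A :: l) = List.replicate M 4 ++ (A ++ separated M l) := by
  simp [separated]

theorem List.prefix_append_cases {α : Type*} {s u v : List α} (h : s <+: u ++ v) :
    s <+: u ∨ ∃ t, s = u ++ t ∧ t <+: v := by
  obtain ⟨r, hr⟩ := h
  rw [List.append_eq_append_iff] at hr
  rcases hr with ⟨w, rfl, -⟩ | ⟨w, rfl, rfl⟩
  · exact .inl (List.prefix_append _ _)
  · exact .inr ⟨w, rfl, List.prefix_append _ _⟩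

theorem List.suffix_append_cases {α : Type*} {s u v : List α} (h : s <:+ u ++ v) :
    s <:+ v ∨ ∃ t, s = t ++ v ∧ t <:+ u := by
  obtain ⟨r, hr⟩ := h
  rw [List.append_eq_append_iff] at hr
  rcases hr with ⟨w, rfl, rfl⟩ | ⟨w, rfl, rfl⟩
  · exact .inr ⟨w, rfl, List.suffix_append _ _⟩
  · exact .inl (List.suffix_append _ _)

/-- The number of symbols other than the separator symbol. -/
abbrev weight (s : List (Fin 5)) : ℕ := s.countP (· ≠ 4)

/-- The number of separator symbols. -/
abbrev sepCount (s : List (Fin 5)) : ℕ := s.countP (· = 4)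

theorem weight_eq_length {s : List (Fin 5)} (h : 4 ∉ s) : weight s = s.length := by
  rw [weight, List.countP_eq_length]
  intro a ha
  simp only [ne_eq, decide_eq_true_eq]
  rintro rfl
  exact h ha

theorem weight_replicate (p : ℕ) : weight (List.replicate p 4) = 0 := by
  simp [weight, List.countP_replicate]

theorem sepCount_replicate (p : ℕ) : sepCount (List.replicate p 4) = p := by
  simp [sepCount, List.countP_replicate]

theorem weight_append (s t : List (Fin 5)) : weight (s ++ t) = weight s + weight t :=
  List.countP_append

theorem sepCount_append (s t : List (Fin 5)) : sepCount (s ++ t) = sepCount s + sepCount t :=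
  List.countP_append

theorem weight_separated {M L : ℕ} {l : List (List (Fin 5))}
    (hl : ∀ A ∈ l, A.length = L ∧ 4 ∉ A) : weight (separated M l) = l.length * L := by
  induction l with
  | nil => simp [separated]
  | cons A l ih =>
    rw [separated_cons, weight_append, weight_append, weight_replicate,
      weight_eq_length (hl A (by simp)).2, (hl A (by simp)).1,
      ih fun A hA => hl A (by simp [hA])]
    simp only [List.length_cons]; ring

theorem eq_replicate_of_infix {p : ℕ} {s : List (Fin 5)} (h : s <:+: List.replicate p 4) :
    s = List.replicate s.length 4 :=
  List.eq_replicate_iff.2 ⟨rfl, fun _ ha => List.eq_of_mem_replicate (h.subset ha)⟩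

/-- A prefix of separators of length `3 * L` and gadgets of length `L` has at least three symbols
`4` for each other symbol, and it starts with a whole separator unless it has only symbols `4`. -/
theorem prefix_separated {L : ℕ} {l : List (List (Fin 5))} {s : List (Fin 5)}
    (hl : ∀ A ∈ l, A.length = L) (hs : s <+: separated (3 * L) l ++ [4]) :
    3 * weight s ≤ sepCount s ∧ (s = List.replicate s.length 4 ∨ 3 * L ≤ sepCount s) := by
  have hrep : ∀ {s : List (Fin 5)} {p : ℕ}, s <+: List.replicate p 4 →
      3 * weight s ≤ sepCount s ∧ (s = List.replicate s.length 4 ∨ 3 * L ≤ sepCount s) := by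
    intro s p h
    have h := eq_replicate_of_infix h.isInfix
    refine ⟨?_, .inl h⟩
    rw [h, weight_replicate]; omega
  induction l generalizing s with
  | nil => exact hrep (p := 1) (by simpa [separated] using hs)
  | cons A l ih =>
    rw [separated_cons, List.append_assoc, List.append_assoc] at hs
    rcases List.prefix_append_cases hs with hs | ⟨t, rfl, ht⟩
    · exact hrep hs
    have hA := hl A (by simp)
    rcases List.prefix_append_cases ht with ht | ⟨t', rfl, ht'⟩
    · have := ht.length_le
      have : weight t ≤ t.length := List.countP_le_length
      simp only [weight_append, sepCount_append, weight_replicate, sepCount_replicate]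
      omega
    · have := (ih (fun A hA => hl A (by simp [hA])) ht').1
      have : weight A ≤ A.length := List.countP_le_length
      simp only [weight_append, sepCount_append, weight_replicate, sepCount_replicate]
      omega

/-- An infix of a separated list of gadgets of length `L` either contains a whole separator, and
then separator symbols prevail, or it touches at most one gadget. Separators of length `3 * L`
suffice: the part of a gadget before the first separator in the infix adds at most `L` to the
weight, and what follows has three separator symbols for each other symbol. -/
theorem infix_separated {L : ℕ} {l : List (List (Fin 5))} {s : List (Fin 5)}
    (hl : ∀ A ∈ l, A.length = L) (hs : s <:+: separated (3 * L) l ++ [4]) :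
    weight s = 0 ∨ weight s + L ≤ sepCount s ∨
      ∃ A ∈ l, ∃ u t v p q, A = u ++ t ++ v ∧
        s = List.replicate p 4 ++ t ++ List.replicate q 4 := by
  obtain ⟨z, hsz, hz⟩ := List.infix_iff_prefix_suffix.1 hs
  clear hs
  have hrep : ∀ {s : List (Fin 5)} {p : ℕ}, s <:+: List.replicate p 4 → weight s = 0 := by
    intro s p h
    rw [eq_replicate_of_infix h, weight_replicate]
  induction l with
  | nil =>
    exact .inl (hrep (p := 1) (hsz.isInfix.trans (by simpa [separated] using hz.isInfix)))
  | cons A l ih =>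
    have hl' : ∀ A ∈ l, A.length = L := fun A hA => hl A (by simp [hA])
    have hA := hl A (by simp)
    rw [separated_cons, ← List.append_assoc, List.append_assoc] at hz
    rcases List.suffix_append_cases hz with hz | ⟨z', rfl, hz'⟩
    · rcases ih hl' hz with h | h | ⟨B, hB, h⟩
      · exact .inl h
      · exact .inr (.inl h)
      · exact .inr (.inr ⟨B, by simp [hB], h⟩)
    obtain ⟨p, A₁, A₂, rfl, rfl⟩ : ∃ p A₁ A₂, A = A₁ ++ A₂ ∧
        z' = List.replicate p 4 ++ A₂ := by
      rcases List.suffix_append_cases hz' with ⟨A₁, rfl⟩ | ⟨t, rfl, ht⟩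
      · exact ⟨0, A₁, z', rfl, by simp⟩
      · exact ⟨t.length, [], A, rfl, by rw [← eq_replicate_of_infix ht.isInfix]⟩
    rw [List.append_assoc] at hsz
    rcases List.prefix_append_cases hsz with hsz | ⟨t, rfl, ht⟩
    · exact .inl (hrep hsz.isInfix)
    rcases List.prefix_append_cases ht with ⟨v, rfl⟩ | ⟨t', rfl, ht'⟩
    · exact .inr (.inr ⟨_, List.mem_cons_self, A₁, t, v, p, 0, by simp, by simp⟩)
    obtain ⟨h₁, h₂ | h₂⟩ := prefix_separated hl' ht'
    · exact .inr (.inr ⟨_, List.mem_cons_self, A₁, A₂, [], p, t'.length, by simp,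
      by rw [← h₂]; simp⟩)
    · right; left
      have : weight A₂ ≤ A₂.length := List.countP_le_length
      simp only [weight_append, sepCount_append, weight_replicate, List.length_append] at hA ⊢
      omega

/-- A gadget `B` of the second list that is aligned with the infix `s` of the first sequence costs
the weight of `s` and the excess `V - L`, if it costs at least `V` with every gadget of the first
list. -/
theorem AlignCost.weight_add_le {L V k : ℕ} {l : List (List (Fin 5))} {s B : List (Fin 5)}
    (hl : ∀ A ∈ l, A.length = L ∧ 4 ∉ A) (hB : 4 ∉ B) (hV : V ≤ L)
    (hpair : ∀ A ∈ l, ∀ k, AlignCost A B k → V ≤ k)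
    (hs : s <:+: separated (3 * L) l ++ [4]) (H : AlignCost s B k) : weight s + V ≤ k + L := by
  rcases infix_separated (fun A hA => (hl A hA).1) hs with h | h | ⟨A, hA, u, t, v, p, q, rfl, rfl⟩
  · omega
  · have h₁ : sepCount s ≤ k := by
      refine le_trans (List.countP_mono_left fun a _ ha => ?_) H.countP_notMem_le
      simp only [decide_eq_true_eq] at ha ⊢
      exact ha ▸ hB
    omega
  · rcases eq_or_ne t [] with rfl | ht
    · simp only [weight_append, weight_replicate, weight, List.countP_nil]; omega
    obtain ⟨k', hk, h'⟩ := H.complete_infix (u := u) (v := v) ht hB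
    have h₁ := hpair _ hA k' h'
    obtain ⟨h₂, h₃⟩ := hl _ hA
    have h₄ : weight t = t.length := weight_eq_length fun h => h₃ (by simp [h])
    simp only [weight_append, weight_replicate, List.length_append] at h₂ ⊢
    omega

/-- If every pair of gadgets costs at least `V`, the sum of `AlignCost.weight_add_le` over the
gadgets of the second sequence bounds the cost of the two sequences. -/
theorem AlignCost.weight_add_length_mul_le {L V e k : ℕ} {l l' : List (List (Fin 5))}
    {x : List (Fin 5)} (hl : ∀ A ∈ l, A.length = L ∧ 4 ∉ A) (hl' : ∀ B ∈ l', B ≠ [] ∧ 4 ∉ B)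
    (hV : V ≤ L) (hL : 0 < L) (he : 0 < e)
    (hpair : ∀ A ∈ l, ∀ B ∈ l', ∀ k, AlignCost A B k → V ≤ k)
    (hx : x <:+: separated (3 * L) l ++ [4])
    (H : AlignCost x (separated (3 * L) l' ++ List.replicate e 4) k) :
    weight x + l'.length * V ≤ k + l'.length * L := by
  have hrep : ∀ {x : List (Fin 5)} {p k : ℕ}, AlignCost x (List.replicate p 4) k →
      weight x ≤ k := by
    intro x p k h
    refine le_trans (List.countP_mono_left fun a _ ha => ?_) h.countP_notMem_le
    simp only [ne_eq, decide_eq_true_eq, List.mem_replicate, not_and] at ha ⊢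
    exact fun _ => ha
  induction l' generalizing x k with
  | nil => simpa using hrep (by simpa [separated] using H)
  | cons B l' ih =>
    obtain ⟨hB, hB4⟩ := hl' B (by simp)
    rw [separated_cons, List.append_assoc, List.append_assoc] at H
    obtain ⟨k₁, k₂, x₁, x₂, hk, hx₁, hx₂, h₁, h₂, hc⟩ :=
      H.split_right_countP (by simp; omega) (by simp [hB])
    obtain ⟨k₃, k₄, x₃, x₄, hk', hx₃, hx₄, h₃, h₄, hc'⟩ :=
      h₂.split_right_countP hB (by simp; omega)
    have i₁ := hrep h₁
    have i₃ := h₃.weight_add_le hl hB4 hV (fun A hA => hpair A hA B (by simp))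
      (hx₃.trans (hx₂.trans hx))
    have i₄ := ih (fun B hB => hl' B (by simp [hB]))
      (fun A hA B hB => hpair A hA B (by simp [hB])) (hx₄.trans (hx₂.trans hx)) h₄
    have j₁ := hc (· ≠ 4)
    have j₂ := hc' (· ≠ 4)
    simp only [List.length_cons, add_mul, one_mul]
    unfold weight at *
    omega

section UpperBound

variable {M L V e : ℕ}

/-- The first marker skips the gadgets of `s` while the second one waits at a separator symbol. -/
theorem alignCost_skip {l l' : List (List (Fin 5))} {k : ℕ} (hM : 0 < M) (he : 0 < e)
    (s : List (List (Fin 5))) (hs : ∀ A ∈ s, A.length = L ∧ 4 ∉ A)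
    (H : AlignCost (separated M l ++ [4]) (separated M l' ++ List.replicate e 4) k) :
    AlignCost (separated M (s ++ l) ++ [4]) (separated M l' ++ List.replicate e 4)
      (s.length * L + k) := by
  obtain ⟨y, hy⟩ : ∃ y, separated M l' ++ List.replicate e 4 = 4 :: y := by
    obtain ⟨M, rfl⟩ := Nat.exists_eq_succ_of_ne_zero hM.ne'
    obtain ⟨e, rfl⟩ := Nat.exists_eq_succ_of_ne_zero he.ne'
    cases l' with
    | nil => exact ⟨_, by simp [separated, List.replicate_succ]; rfl⟩
    | cons B l' => exact ⟨_, by simp [separated_cons, List.replicate_succ]; rfl⟩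
  rw [hy] at H ⊢
  have := H.prepend (separated M s)
  rw [show (separated M s).countP (· ≠ 4) = s.length * L from weight_separated hs] at this
  simpa [separated] using this

theorem alignCost_pair {l l' : List (List (Fin 5))} {A B : List (Fin 5)} {k k' : ℕ} (hM : 0 < M)
    (hAB : AlignCost A B k')
    (H : AlignCost (separated M l ++ [4]) (separated M l' ++ List.replicate e 4) k) :
    AlignCost (separated M (A :: l) ++ [4]) (separated M (B :: l') ++ List.replicate e 4)
      (k' + k) := by
  have := (AlignCost.replicate (4 : Fin 5) hM hM).append (hAB.append H)
  simpa [separated_cons] using this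

/-- The gadgets of `s` in the second sequence are paired with copies of the gadget `Z`. -/
theorem alignCost_pairs {l l' : List (List (Fin 5))} {Z : List (Fin 5)} {k : ℕ} (hM : 0 < M)
    (s : List (List (Fin 5))) (hs : ∀ B ∈ s, AlignCost Z B V)
    (H : AlignCost (separated M l ++ [4]) (separated M l' ++ List.replicate e 4) k) :
    AlignCost (separated M (List.replicate s.length Z ++ l) ++ [4])
      (separated M (s ++ l') ++ List.replicate e 4) (s.length * V + k) := by
  induction s with
  | nil => simpa using H
  | cons B s ih =>
    have := alignCost_pair hM (hs B (by simp)) (ih fun B hB => hs B (by simp [hB]))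
    have hlen : (B :: s).length * V + k = V + (s.length * V + k) := by
      rw [List.length_cons]; ring
    rw [hlen]
    exact this

end UpperBound

/-- The gadgets of the first sequence: those of the list, with `l.length` dummies before and
after them. -/
def withDummies (Z : List (Fin 5)) (l : List (List (Fin 5))) : List (List (Fin 5)) :=
  List.replicate l.length Z ++ (l ++ List.replicate l.length Z)

/-- Pair `A` with `B`, the other gadgets of the second list with dummies, and skip the rest. -/
theorem alignCost_of_pair {M L V e v : ℕ} {l l' : List (List (Fin 5))} {A B Z : List (Fin 5)}
    (hM : 0 < M) (he : 0 < e) (hlen : l.length = l'.length)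
    (hl : ∀ A ∈ Z :: l, A.length = L ∧ 4 ∉ A) (hZ : ∀ B ∈ l', AlignCost Z B V)
    (hA : A ∈ l) (hB : B ∈ l') (hAB : AlignCost A B v) :
    ∃ k, k + V = 2 * l.length * L + l.length * V + v ∧
      AlignCost (separated M (withDummies Z l) ++ [4])
        (separated M l' ++ List.replicate e 4) k := by
  obtain ⟨a₁, a₂, rfl⟩ := List.append_of_mem hA
  obtain ⟨b₁, b₂, rfl⟩ := List.append_of_mem hB
  have h₀ : AlignCost (separated M [] ++ [4]) (separated M [] ++ List.replicate e 4) 0 := by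
    simpa [separated] using AlignCost.replicate (4 : Fin 5) one_pos he
  have hdummy : ∀ p, ∀ A ∈ List.replicate p Z, A.length = L ∧ 4 ∉ A := by
    intro p A hA
    rw [List.eq_of_mem_replicate hA]
    exact hl Z (by simp)
  have h₁ := alignCost_skip hM he (List.replicate (b₁.length + 1) Z) (hdummy _) h₀
  have h₂ := alignCost_pairs hM b₂ (fun B hB => hZ B (by simp [hB])) h₁
  have h₃ := alignCost_skip (L := L) hM he a₂ (fun A hA => hl A (by simp [hA])) h₂
  have h₄ := alignCost_pair hM hAB h₃
  have h₅ := alignCost_skip (L := L) hM he a₁ (fun A hA => hl A (by simp [hA])) h₄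
  have h₆ := alignCost_skip hM he (List.replicate (b₂.length + 1) Z) (hdummy _) h₅
  have h₇ := alignCost_pairs hM b₁ (fun B hB => hZ B (by simp [hB])) h₆
  have hx : withDummies Z (a₁ ++ A :: a₂) = List.replicate b₁.length Z ++
      (List.replicate (b₂.length + 1) Z ++ (a₁ ++ A :: (a₂ ++ (List.replicate b₂.length Z ++
        (List.replicate (b₁.length + 1) Z ++ []))))) := by
    have h₁ : (a₁ ++ A :: a₂).length = b₁.length + (b₂.length + 1) := by simp [hlen]
    have h₂ : (a₁ ++ A :: a₂).length = b₂.length + (b₁.length + 1) := by omega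
    have h₃ : List.replicate (a₁ ++ A :: a₂).length Z =
        List.replicate b₁.length Z ++ List.replicate (b₂.length + 1) Z := by
      rw [h₁, List.replicate_add]
    have h₄ : List.replicate (a₁ ++ A :: a₂).length Z =
        List.replicate b₂.length Z ++ List.replicate (b₁.length + 1) Z := by
      rw [h₂, List.replicate_add]
    rw [withDummies]
    nth_rewrite 1 [h₃]
    rw [h₄]
    simp only [List.append_assoc, List.cons_append, List.append_nil]
  rw [List.append_nil b₂, ← hx] at h₇
  refine ⟨_, ?_, h₇⟩
  simp only [List.length_append, List.length_cons, List.length_replicate] at hlen ⊢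
  have h₈ : a₁.length + a₂.length = b₁.length + b₂.length := by omega
  have h₉ : a₁.length * L + a₂.length * L = b₁.length * L + b₂.length * L := by
    rw [← add_mul, h₈, add_mul]
  rw [hlen]
  linarith

/-! ### Traversals and their costs -/

/-- The rules of `AlignCost` for the suffixes of two sequences from the positions `i` and `j` on
build a traversal of these suffixes. -/
theorem AlignCost.exists_traversal {S : Type*} [DecidableEq S] {x y : List S} {k : ℕ}
    (H : AlignCost x y k) {m n : ℕ} {f : Fin m → S} {g : Fin n → S} {i j : ℕ}
    (hx : x = (List.ofFn f).drop i) (hy : y = (List.ofFn g).drop j) :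
    ∃ p T, p.1.val = i ∧ p.2.val = j ∧ (∃ q ∈ (p :: T).getLast?, q.1.val + 1 = m ∧
      q.2.val + 1 = n) ∧ (p :: T).IsChain MarkerMove ∧
        traversalCost symbolDist f g (p :: T) = k := by
  have head : ∀ {n : ℕ} {f : Fin n → S} {i : ℕ} {a : S} {x : List S},
      a :: x = (List.ofFn f).drop i →
        ∃ h : i < n, f ⟨i, h⟩ = a ∧ x = (List.ofFn f).drop (i + 1) := by
    intro n f i a x h
    have hi : i < (List.ofFn f).length := by
      by_contra hi
      rw [List.drop_eq_nil_of_le (by omega)] at h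
      cases h
    rw [List.drop_eq_getElem_cons hi] at h
    obtain ⟨h₁, h₂⟩ := List.cons_eq_cons.1 h
    exact ⟨by simpa using hi, by simpa using h₁.symm, h₂⟩
  have length : ∀ {n : ℕ} {f : Fin n → S} {i : ℕ}, [] = (List.ofFn f).drop i → n ≤ i := by
    intro n f i h
    simpa using List.drop_eq_nil_iff.1 h.symm
  induction H generalizing i j with
  | single a b =>
    obtain ⟨hi, rfl, hi'⟩ := head hx
    obtain ⟨hj, rfl, hj'⟩ := head hy
    have := length hi'
    have := length hj'
    exact ⟨(⟨i, hi⟩, ⟨j, hj⟩), [], rfl, rfl, ⟨_, rfl, by simp; omega, by simp; omega⟩, by simp,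
      by simp [traversalCost]⟩
  | left a b _ ih =>
    obtain ⟨hi, rfl, hi'⟩ := head hx
    obtain ⟨hj, rfl, -⟩ := head hy
    obtain ⟨p, T, hp₁, hp₂, hl, hT, hc⟩ := ih hi' hy
    refine ⟨(⟨i, hi⟩, ⟨j, hj⟩), p :: T, rfl, rfl, by simpa using hl, ?_, ?_⟩
    · exact .cons_cons (.inl ⟨hp₁, hp₂⟩) hT
    · rw [← hc]; simp [traversalCost]
  | right a b _ ih =>
    obtain ⟨hi, rfl, -⟩ := head hx
    obtain ⟨hj, rfl, hj'⟩ := head hy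
    obtain ⟨p, T, hp₁, hp₂, hl, hT, hc⟩ := ih hx hj'
    refine ⟨(⟨i, hi⟩, ⟨j, hj⟩), p :: T, rfl, rfl, by simpa using hl, ?_, ?_⟩
    · exact .cons_cons (.inr (.inl ⟨hp₁, hp₂⟩)) hT
    · rw [← hc]; simp [traversalCost]
  | diag a b _ ih =>
    obtain ⟨hi, rfl, hi'⟩ := head hx
    obtain ⟨hj, rfl, hj'⟩ := head hy
    obtain ⟨p, T, hp₁, hp₂, hl, hT, hc⟩ := ih hi' hj'
    refine ⟨(⟨i, hi⟩, ⟨j, hj⟩), p :: T, rfl, rfl, by simpa using hl, ?_, ?_⟩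
    · exact .cons_cons (.inr (.inr ⟨hp₁, hp₂⟩)) hT
    · rw [← hc]; simp [traversalCost]

theorem alignCost_of_chain {S : Type*} [DecidableEq S] {m n : ℕ} {f : Fin m → S} {g : Fin n → S}
    {T : List (Fin m × Fin n)} {p : Fin m × Fin n}
    (hl : ∃ q ∈ (p :: T).getLast?, q.1.val + 1 = m ∧ q.2.val + 1 = n)
    (hT : (p :: T).IsChain MarkerMove) :
    AlignCost ((List.ofFn f).drop p.1) ((List.ofFn g).drop p.2)
      (traversalCost symbolDist f g (p :: T)) := by
  have drop : ∀ {n : ℕ} (f : Fin n → S) (i : Fin n),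
      (List.ofFn f).drop i = f i :: (List.ofFn f).drop (i + 1) := by
    intro n f i
    rw [List.drop_eq_getElem_cons (by simp)]
    simp
  induction T generalizing p with
  | nil =>
    obtain ⟨q, hq, h₁, h₂⟩ := hl
    obtain rfl : p = q := by simpa using hq
    rw [drop, drop, List.drop_eq_nil_of_le (by simp; omega),
      List.drop_eq_nil_of_le (by simp; omega)]
    simpa [traversalCost] using AlignCost.single (f p.1) (g p.2)
  | cons q T ih =>
    have ih := ih (p := q) (by simpa using hl) hT.tail
    have hc : traversalCost symbolDist f g (p :: q :: T) = symbolDist (f p.1) (g p.2) +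
        traversalCost symbolDist f g (q :: T) := by simp [traversalCost]
    rw [hc]
    rcases (List.isChain_cons_cons.1 hT).1 with ⟨h₁, h₂⟩ | ⟨h₁, h₂⟩ | ⟨h₁, h₂⟩
    · rw [h₁, h₂, drop g] at ih
      rw [drop f, drop g]
      exact .left _ _ ih
    · rw [h₁, h₂, drop f] at ih
      rw [drop f, drop g]
      exact .right _ _ ih
    · rw [h₁, h₂] at ih
      rw [drop f, drop g]
      exact .diag _ _ ih

/-- The distance of two sequences is the least `k` with `AlignCost`. -/
theorem isDTWD_iff {S : Type*} [DecidableEq S] {m n : ℕ} {f : Fin m → S} {g : Fin n → S} {v : ℕ} :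
    IsDTWD symbolDist f g v ↔ IsLeast {k | AlignCost (List.ofFn f) (List.ofFn g) k} v := by
  unfold IsDTWD
  congr! 1
  ext k
  constructor
  · rintro ⟨T, ⟨⟨p, hp, h₁, h₂⟩, hl, hT⟩, rfl⟩
    obtain ⟨T, rfl⟩ : ∃ T', T = p :: T' := by
      cases T with
      | nil => simp at hp
      | cons q T => exact ⟨T, by simpa using hp⟩
    simpa [h₁, h₂] using alignCost_of_chain (f := f) (g := g) hl hT
  · intro H
    obtain ⟨p, T, h₁, h₂, hl, hT, hc⟩ := H.exists_traversal (i := 0) (j := 0) rfl rfl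
    exact ⟨p :: T, ⟨⟨p, rfl, h₁, h₂⟩, hl, hT⟩, hc⟩

/-! ### The two sequences -/

/-- Coordinate `h` of vector `i`, as a bit; `false` out of range. -/
def natBits {n d : ℕ} (α : Fin n → Fin d → Fin 2) (i h : ℕ) : Bool :=
  if H : i < n ∧ h < d then α ⟨i, H.1⟩ ⟨h, H.2⟩ = 1 else false

/-- The gadgets of the vectors of the first list, extended by `r + 1` coordinates `0`. The runs
have length `2 * (d + r + 1)`, which is at least the cost `d + r + 1 + (r + 1)` of a dummy, so that
a misalignment of runs never pays. -/
def leftGadgets {n d : ℕ} (α : Fin n → Fin d → Fin 2) (r : ℕ) : List (List (Fin 5)) :=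
  (List.range n).map fun i => leftGadget (2 * (d + r + 1)) (d + r + 1) (natBits α i)

/-- The gadgets of the vectors of the second list, extended by `r + 1` coordinates `1`. -/
def rightGadgets {n d : ℕ} (β : Fin n → Fin d → Fin 2) (r : ℕ) : List (List (Fin 5)) :=
  (List.range n).map fun j => rightGadget (2 * (d + r + 1)) (d + r + 1)
    fun h => natBits β j h || decide (d ≤ h)

/-- The dummy gadget: the vector with `d` coordinates `0` and `r + 1` coordinates `1`, which has
inner product `r + 1` with every extended vector of the second list. -/
def dummyGadget (d r : ℕ) : List (Fin 5) :=
  leftGadget (2 * (d + r + 1)) (d + r + 1) fun h => decide (d ≤ h)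

/-- The length of a gadget. -/
def gadgetLength (d r : ℕ) : ℕ := (d + r + 1) * (2 * (2 * (d + r + 1)) + 2)

/-- The length of the two sequences: `3 * n` gadgets with separators and a final symbol `4`. -/
def seqLength (n d r : ℕ) : ℕ := 3 * n * (4 * gadgetLength d r) + 1

/-- The first sequence. The dummies on both sides let every pair of vectors be aligned while the
other gadgets of the second sequence meet dummies. -/
def leftSeq {n d : ℕ} (α : Fin n → Fin d → Fin 2) (r : ℕ) : List (Fin 5) :=
  separated (3 * gadgetLength d r) (withDummies (dummyGadget d r) (leftGadgets α r)) ++ [4]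

/-- The second sequence, padded with separator symbols to the length of the first one. -/
def rightSeq {n d : ℕ} (β : Fin n → Fin d → Fin 2) (r : ℕ) : List (Fin 5) :=
  separated (3 * gadgetLength d r) (rightGadgets β r) ++
    List.replicate (2 * n * (4 * gadgetLength d r) + 1) 4

/-- The distance of the two sequences is below this number exactly if there is a far pair. -/
def costThreshold (n d r : ℕ) : ℕ := 2 * n * gadgetLength d r + n * (d + r + 1 + (r + 1))

theorem bitInner_extend {n d : ℕ} (α β : Fin n → Fin d → Fin 2) (r : ℕ) (i j : Fin n) :
    bitInner (d + r + 1) (natBits α i) (fun h => natBits β j h || decide (d ≤ h)) =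
      ∑ h : Fin d, (α i h).val * (β j h).val := by
  rw [bitInner, add_assoc, Finset.sum_range_add, Finset.sum_eq_zero (s := Finset.range (r + 1)),
    add_zero, Finset.sum_range]
  · refine Finset.sum_congr rfl fun h _ => ?_
    have hh := h.2
    simp only [natBits, i.2, j.2, hh, and_self, dite_true, Fin.eta, not_le.2 hh, decide_false,
      Bool.or_false]
    generalize α i h = a
    generalize β j h = b
    revert a b
    decide
  · intro h _
    simp [natBits]

theorem bitInner_dummy {n d : ℕ} (β : Fin n → Fin d → Fin 2) (r j : ℕ) :
    bitInner (d + r + 1) (fun h => decide (d ≤ h)) (fun h => natBits β j h || decide (d ≤ h)) =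
      r + 1 := by
  rw [bitInner, add_assoc, Finset.sum_range_add, Finset.sum_eq_zero (s := Finset.range d)]
  · simp
  · intro h hh
    simp [not_le.2 (Finset.mem_range.1 hh)]

/-- There is a far pair exactly if the two sequences have a traversal that is cheaper than
pairing every gadget of the second list at the cost of a dummy. -/
theorem hasFarPair_iff {n d r v : ℕ} (α β : Fin n → Fin d → Fin 2)
    (hv : IsLeast {k | AlignCost (leftSeq α r) (rightSeq β r) k} v) :
    HasFarPair α β r ↔ v < costThreshold n d r := by
  set K := 2 * (d + r + 1) with hK
  set m := d + r + 1 with hm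
  set L := gadgetLength d r with hL
  have hL' : L = m * (2 * K + 2) := rfl
  have hmL : 2 * m ≤ L := by rw [hL']; nlinarith
  have hleft : ∀ A ∈ dummyGadget d r :: leftGadgets α r, A.length = L ∧ 4 ∉ A := by
    intro A hA
    obtain ⟨a, rfl⟩ : ∃ a, A = leftGadget K m a := by
      rcases List.mem_cons.1 hA with rfl | hA
      · exact ⟨_, rfl⟩
      · obtain ⟨i, -, rfl⟩ := List.mem_map.1 hA
        exact ⟨_, rfl⟩
    exact ⟨length_leftGadget K m a, four_notMem_leftGadget K m a⟩
  have hright : ∀ B ∈ rightGadgets β r, B ≠ [] ∧ 4 ∉ B := by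
    intro B hB
    obtain ⟨j, -, rfl⟩ := List.mem_map.1 hB
    refine ⟨fun h => ?_, four_notMem_rightGadget K m _⟩
    have := congrArg List.length h
    rw [length_rightGadget] at this
    simp at this
  constructor
  · rintro ⟨i, j, hij⟩
    have hA : leftGadget K m (natBits α i) ∈ leftGadgets α r :=
      List.mem_map.2 ⟨i, by simp, rfl⟩
    have hB : rightGadget K m (fun h => natBits β j h || decide (d ≤ h)) ∈ rightGadgets β r :=
      List.mem_map.2 ⟨j, by simp, rfl⟩
    have hZ : ∀ B ∈ rightGadgets β r, AlignCost (dummyGadget d r) B (m + (r + 1)) := by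
      intro B hB
      obtain ⟨j, -, rfl⟩ := List.mem_map.1 hB
      have := alignCost_gadgets (K := K) (m := m) (by omega) (by omega) (fun h => decide (d ≤ h))
        (fun h => natBits β j h || decide (d ≤ h))
      rwa [bitInner_dummy] at this
    have hAB := alignCost_gadgets (K := K) (m := m) (by omega) (by omega) (natBits α i)
        (fun h => natBits β j h || decide (d ≤ h))
    rw [bitInner_extend] at hAB
    obtain ⟨k, hk, H⟩ := alignCost_of_pair (M := 3 * L) (e := 2 * n * (4 * L) + 1) (by omega)
      (by omega) (by simp [leftGadgets, rightGadgets]) hleft hZ hA hB hAB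
    have hvk : v ≤ k := hv.2 H
    have hlen : (leftGadgets α r).length = n := by simp [leftGadgets]
    rw [hlen] at hk
    rw [costThreshold, ← hL, ← hm]
    omega
  · intro hlt
    by_contra hno
    have hpair : ∀ A ∈ withDummies (dummyGadget d r) (leftGadgets α r), ∀ B ∈ rightGadgets β r,
        ∀ k, AlignCost A B k → m + (r + 1) ≤ k := by
      intro A hA B hB k H
      obtain ⟨j, hj, rfl⟩ := List.mem_map.1 hB
      have hA' : A = dummyGadget d r ∨ A ∈ leftGadgets α r := by
        simp only [withDummies, List.mem_append, List.mem_replicate] at hA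
        tauto
      rcases hA' with rfl | hA
      · have := AlignCost.le_of_gadgets H
        rw [bitInner_dummy] at this
        omega
      · obtain ⟨i, hi, rfl⟩ := List.mem_map.1 hA
        have := AlignCost.le_of_gadgets H
        have hinner := bitInner_extend α β r ⟨i, by simpa using hi⟩ ⟨j, by simpa using hj⟩
        simp only at hinner
        rw [hinner] at this
        have : r < ∑ h : Fin d, (α ⟨i, by simpa using hi⟩ h).val *
            (β ⟨j, by simpa using hj⟩ h).val := by
          by_contra hle
          exact hno ⟨_, _, not_lt.1 hle⟩
        omega
    have hall : ∀ A ∈ withDummies (dummyGadget d r) (leftGadgets α r), A.length = L ∧ 4 ∉ A := by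
      intro A hA
      refine hleft A ?_
      simp only [withDummies, List.mem_append, List.mem_replicate] at hA
      simp only [List.mem_cons]
      tauto
    have H := AlignCost.weight_add_length_mul_le (L := L) hall hright (by omega) (by omega)
      (by omega) hpair (List.infix_refl _) hv.1
    have hw : weight (leftSeq α r) = 3 * n * L := by
      have h₁ : (withDummies (dummyGadget d r) (leftGadgets α r)).length = 3 * n := by
        simp [withDummies, leftGadgets]; omega
      have h₂ : weight [4] = 0 := rfl
      rw [leftSeq, weight_append, weight_separated hall, h₁, h₂, add_zero]
    have hlen : (rightGadgets β r).length = n := by simp [rightGadgets]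
    rw [hlen] at H
    change weight (leftSeq α r) + _ ≤ _ at H
    rw [hw] at H
    rw [costThreshold, ← hL, ← hm] at hlt
    have : 3 * n * L = 2 * n * L + n * L := by ring
    omega

namespace WordRAM

/-! ### Executions of programs -/

theorem run_add (w : ℕ) (P : Program) (t₁ t₂ : ℕ) (s : State) :
    run w P (t₁ + t₂) s = (run w P t₁ s).bind (run w P t₂) := by
  induction t₁ generalizing s with
  | zero => simp [run]
  | succ t₁ ih =>
    rw [Nat.succ_add, run, run, Option.bind_assoc]
    congr 1
    funext s'
    exact ih s'

theorem run_trans {w : ℕ} {P : Program} {t₁ t₂ : ℕ} {s s' s'' : State}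
    (h₁ : run w P t₁ s = some s') (h₂ : run w P t₂ s' = some s'') :
    run w P (t₁ + t₂) s = some s'' := by
  rw [run_add, h₁]; exact h₂

theorem run_one {w : ℕ} {P : Program} {s s' : State} (h : step w P s = some s') :
    run w P 1 s = some s' := by
  rw [run, h]; rfl

/-- The instructions `c` stand in the program `P` from number `pos` on. -/
def CodeAt (P : Program) (pos : ℕ) (c : List Instr) : Prop :=
  ∃ u v, P = u ++ (c ++ v) ∧ u.length = pos

theorem CodeAt.left {P : Program} {pos : ℕ} {c₁ c₂ : List Instr} (h : CodeAt P pos (c₁ ++ c₂)) :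
    CodeAt P pos c₁ := by
  obtain ⟨u, v, rfl, hu⟩ := h
  exact ⟨u, c₂ ++ v, by simp, hu⟩

theorem CodeAt.right {P : Program} {pos : ℕ} {c₁ c₂ : List Instr} (h : CodeAt P pos (c₁ ++ c₂)) :
    CodeAt P (pos + c₁.length) c₂ := by
  obtain ⟨u, v, rfl, hu⟩ := h
  exact ⟨u ++ c₁, v, by simp, by simp [hu]⟩

theorem CodeAt.getElem? {P : Program} {pos i : ℕ} {code : List Instr}
    (h : CodeAt P pos code) (hi : i < code.length) : P[pos + i]? = code[i]? := by
  obtain ⟨u, v, rfl, rfl⟩ := h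
  rw [List.getElem?_append_right (by omega), Nat.add_sub_cancel_left,
    List.getElem?_append_left hi]

theorem CodeAt.head {P : Program} {pos : ℕ} {I : Instr} {c : List Instr}
    (h : CodeAt P pos (I :: c)) : P[pos]? = some I := by
  simpa using h.getElem? (i := 0) (by simp)

/-! ### Arithmetic expressions -/

/-- Expressions over registers and memory cells. -/
inductive Expr where
  | var (v : ℕ)
  | const (c : ℕ)
  | op (o : BinOp) (a b : Expr)
  | load (a : Expr)

namespace Expr

/-- The value of an expression. -/
def eval (reg mem : ℕ → ℕ) : Expr → ℕ
  | var v => reg v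
  | const c => c
  | op o a b => o.eval (a.eval reg mem) (b.eval reg mem)
  | load a => mem (a.eval reg mem)

/-- The number of leaves, or the exponent in a bound for the value, see `eval_le_pow`. -/
def size : Expr → ℕ
  | var _ => 1
  | const _ => 1
  | op _ a b => a.size + b.size
  | load a => a.size

/-- The expression uses only registers below `k` and constants up to `B`, and only operations
whose values are polynomially bounded, which excludes shifts. -/
def Tame (k B : ℕ) : Expr → Prop
  | var v => v < k
  | const c => c ≤ B
  | op o a b => (o = .add ∨ o = .sub ∨ o = .mul ∨ o = .div ∨ o = .mod) ∧ a.Tame k B ∧ b.Tame k B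
  | load a => a.Tame k B

/-- Code that puts the value of an expression into register `dst`, using the registers from `dst`
on. -/
def compile : ℕ → Expr → List Instr
  | dst, var v => [.op .or dst v v]
  | dst, const c => [.const dst c]
  | dst, op o a b => compile dst a ++ (compile (dst + 1) b ++ [.op o dst dst (dst + 1)])
  | dst, load a => compile dst a ++ [.load dst dst]

theorem size_pos (e : Expr) : 0 < e.size := by
  induction e with
  | var => simp [size]
  | const => simp [size]
  | op o a b iha ihb => simp only [size]; omega
  | load a ih => exact ih

theorem eval_le_pow {k B : ℕ} {reg mem : ℕ → ℕ} (hB : 2 ≤ B) (hreg : ∀ v < k, reg v ≤ B)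
    (hmem : ∀ i, mem i ≤ B) {e : Expr} (he : e.Tame k B) : e.eval reg mem ≤ B ^ e.size := by
  induction e with
  | var v => simpa [eval, size] using hreg v he
  | const c => simpa [eval, size, Tame] using he
  | load a ih => exact (hmem _).trans (Nat.le_self_pow a.size_pos.ne' B)
  | op o a b iha ihb =>
    obtain ⟨ho, ha, hb⟩ := he
    have iha := iha ha
    have ihb := ihb hb
    have ha2 : 2 ≤ B ^ a.size := hB.trans (Nat.le_self_pow a.size_pos.ne' B)
    have hb2 : 2 ≤ B ^ b.size := hB.trans (Nat.le_self_pow b.size_pos.ne' B)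
    simp only [eval, size, pow_add]
    generalize a.eval reg mem = x at *
    generalize b.eval reg mem = y at *
    generalize B ^ a.size = p at *
    generalize B ^ b.size = q at *
    have hpq : p ≤ p * q := Nat.le_mul_of_pos_right p (by omega)
    rcases ho with rfl | rfl | rfl | rfl | rfl <;> simp only [BinOp.eval]
    · nlinarith
    · omega
    · exact Nat.mul_le_mul iha ihb
    · exact (Nat.div_le_self x y).trans (iha.trans hpq)
    · exact (Nat.mod_le x y).trans (iha.trans hpq)

theorem eval_congr {k B : ℕ} {reg reg' mem : ℕ → ℕ} (h : ∀ v < k, reg v = reg' v) {e : Expr}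
    (he : e.Tame k B) : e.eval reg mem = e.eval reg' mem := by
  induction e with
  | var v => exact h v he
  | const c => rfl
  | op o a b iha ihb => simp only [eval, iha he.2.1, ihb he.2.2]
  | load a ih => simp only [eval, ih he]

/-- Compiled expressions are computed correctly if the word size allows for `B ^ size`. -/
theorem run_compile {w : ℕ} {Q : Program} {k B dst : ℕ} {e : Expr} {s : State} (hB : 2 ≤ B)
    (hreg : ∀ v < k, s.reg v ≤ B) (hmem : ∀ i, s.mem i ≤ B) (he : e.Tame k B) (hk : k ≤ dst)
    (hw : B ^ e.size < 2 ^ w) (hQ : CodeAt Q s.pc (compile dst e)) :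
    ∃ s', run w Q (compile dst e).length s = some s' ∧ s'.pc = s.pc + (compile dst e).length ∧
      s'.mem = s.mem ∧ s'.reg dst = e.eval s.reg s.mem ∧ ∀ v < dst, s'.reg v = s.reg v := by
  have hval := eval_le_pow hB hreg hmem he
  induction e generalizing dst s with
  | var v =>
    refine ⟨⟨s.pc + 1, Function.update s.reg dst (s.reg v), s.mem⟩, run_one ?_, rfl, rfl,
      Function.update_self .., fun v hv => Function.update_of_ne hv.ne ..⟩
    rw [step, hQ.head]
    simp only [BinOp.eval, Nat.or_self]
    exact if_pos (lt_of_le_of_lt hval hw)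
  | const c =>
    refine ⟨⟨s.pc + 1, Function.update s.reg dst c, s.mem⟩, run_one ?_, rfl, rfl,
      Function.update_self .., fun v hv => Function.update_of_ne hv.ne ..⟩
    rw [step, hQ.head]
    exact if_pos (lt_of_le_of_lt hval hw)
  | load a ih =>
    obtain ⟨s₁, h₁, hpc, hm, hv, hr⟩ := ih hreg hmem he hk hw hQ.left (eval_le_pow hB hreg hmem he)
    refine ⟨⟨s₁.pc + 1, Function.update s₁.reg dst (s₁.mem (s₁.reg dst)), s₁.mem⟩,
      ?_, ?_, hm, ?_, ?_⟩
    · rw [compile, List.length_append]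
      refine run_trans h₁ (run_one ?_)
      have hI := hQ.right.head
      rw [← hpc] at hI
      rw [step, hI]
      refine if_pos ?_
      rw [hm, hv]
      exact lt_of_le_of_lt hval hw
    · simp [compile, hpc]; omega
    · simp [hm, hv, eval]
    · intro v hv'
      rw [← hr v hv']
      exact Function.update_of_ne hv'.ne ..
  | op o a b iha ihb =>
    have hBa : B ^ a.size ≤ B ^ (op o a b).size := Nat.pow_le_pow_right (by omega) (by simp [size])
    have hBb : B ^ b.size ≤ B ^ (op o a b).size := Nat.pow_le_pow_right (by omega) (by simp [size])
    obtain ⟨s₁, h₁, hpc₁, hm₁, hv₁, hr₁⟩ := iha hreg hmem he.2.1 hk (hBa.trans_lt hw) hQ.left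
      (eval_le_pow hB hreg hmem he.2.1)
    have hreg₁ : ∀ v < k, s₁.reg v ≤ B := fun v hv => by rw [hr₁ v (by omega)]; exact hreg v hv
    have hmem₁ : ∀ i, s₁.mem i ≤ B := fun i => by rw [hm₁]; exact hmem i
    obtain ⟨s₂, h₂, hpc₂, hm₂, hv₂, hr₂⟩ := ihb (s := s₁) (dst := dst + 1) hreg₁ hmem₁ he.2.2
      (by omega) (hBb.trans_lt hw) (by rw [hpc₁]; exact hQ.right.left)
      (eval_le_pow hB hreg₁ hmem₁ he.2.2)
    have hvb : s₂.reg (dst + 1) = b.eval s.reg s.mem := by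
      rw [hv₂, hm₁]
      exact eval_congr (fun v hv => hr₁ v (by omega)) he.2.2
    have hva : s₂.reg dst = a.eval s.reg s.mem := by rw [hr₂ dst (by omega), hv₁]
    refine ⟨⟨s₂.pc + 1, Function.update s₂.reg dst (o.eval (s₂.reg dst) (s₂.reg (dst + 1))),
      s₂.mem⟩, ?_, ?_, hm₂.trans hm₁, ?_, ?_⟩
    · rw [compile, List.length_append, List.length_append]
      refine run_trans h₁ (run_trans h₂ (run_one ?_))
      have hI := hQ.right.right.head
      rw [← hpc₁, ← hpc₂] at hI
      rw [step, hI]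
      refine if_pos ?_
      rw [hva, hvb]
      exact lt_of_le_of_lt hval hw
    · simp [compile, hpc₁, hpc₂]; omega
    · simp [hva, hvb, eval]
    · intro v hv
      rw [← hr₁ v hv, ← hr₂ v (by omega)]
      exact Function.update_of_ne hv.ne ..

/-- `1` if `a < b` and `0` otherwise, by truncated subtraction. -/
def lt (a b : Expr) : Expr := op .sub (const 1) (op .sub (const 1) (op .sub b a))

/-- The value of `x` if `a < b`, and that of `y` otherwise. -/
def ifLt (a b x y : Expr) : Expr :=
  op .add (op .mul (lt a b) x) (op .mul (op .sub (const 1) (lt a b)) y)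

theorem eval_lt (reg mem : ℕ → ℕ) (a b : Expr) :
    (lt a b).eval reg mem = if a.eval reg mem < b.eval reg mem then 1 else 0 := by
  simp only [lt, eval, BinOp.eval]
  split <;> omega

theorem eval_ifLt (reg mem : ℕ → ℕ) (a b x y : Expr) :
    (ifLt a b x y).eval reg mem = if a.eval reg mem < b.eval reg mem then x.eval reg mem
      else y.eval reg mem := by
  simp only [ifLt, eval, eval_lt, BinOp.eval]
  split <;> simp

theorem tame_lt {k B : ℕ} {a b : Expr} (hB : 1 ≤ B) (ha : a.Tame k B) (hb : b.Tame k B) :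
    (lt a b).Tame k B := by
  simp [lt, Tame, ha, hb, hB]

theorem tame_ifLt {k B : ℕ} {a b x y : Expr} (hB : 1 ≤ B) (ha : a.Tame k B) (hb : b.Tame k B)
    (hx : x.Tame k B) (hy : y.Tame k B) : (ifLt a b x y).Tame k B := by
  simp [ifLt, Tame, tame_lt hB ha hb, hx, hy, hB]

end Expr

/-! ### Programs inside programs -/

namespace Instr

/-- All registers of the instruction are below `R`. -/
def RegsLt (R : ℕ) : Instr → Prop
  | const dst _ => dst < R
  | op _ dst a b => dst < R ∧ a < R ∧ b < R
  | load dst addr => dst < R ∧ addr < R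
  | store addr src => addr < R ∧ src < R
  | jump _ => True
  | jumpIfZero a _ => a < R
  | halt => True

/-- The instruction in a program that starts at number `off` and continues at number `next`
instead of halting. -/
def relocate (off next : ℕ) : Instr → Instr
  | jump target => jump (target + off)
  | jumpIfZero a target => jumpIfZero a (target + off)
  | halt => jump next
  | I => I

theorem RegsLt.mono {R R' : ℕ} (h : R ≤ R') {I : Instr} (hI : I.RegsLt R) : I.RegsLt R' := by
  cases I <;> simp only [RegsLt] at hI ⊢ <;> omega

theorem exists_regsLt (I : Instr) : ∃ R, I.RegsLt R := by
  cases I with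
  | const dst _ => exact ⟨dst + 1, Nat.lt_succ_self _⟩
  | op _ dst a b => exact ⟨dst + a + b + 1, by simp only [RegsLt]; omega⟩
  | load dst a => exact ⟨dst + a + 1, by simp only [RegsLt]; omega⟩
  | store a src => exact ⟨a + src + 1, by simp only [RegsLt]; omega⟩
  | jump _ => exact ⟨0, trivial⟩
  | jumpIfZero a _ => exact ⟨a + 1, Nat.lt_succ_self _⟩
  | halt => exact ⟨0, trivial⟩

end Instr

theorem exists_forall_regsLt (P : Program) : ∃ R, ∀ I ∈ P, I.RegsLt R := by
  induction P with
  | nil => exact ⟨0, by simp⟩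
  | cons I P ih =>
    obtain ⟨R, hR⟩ := ih
    obtain ⟨R', hR'⟩ := I.exists_regsLt
    refine ⟨R + R', fun J hJ => ?_⟩
    rcases List.mem_cons.1 hJ with rfl | hJ
    · exact hR'.mono (by omega)
    · exact (hR J hJ).mono (by omega)

/-- The configuration `σ` of a larger program simulates the configuration `s` of a program that
stands at number `off` and uses only registers below `R`. -/
structure Simulates (off R : ℕ) (s σ : State) : Prop where
  pc : σ.pc = s.pc + off
  mem : σ.mem = s.mem
  reg : ∀ v < R, σ.reg v = s.reg v

theorem Simulates.setReg {off R w w' dst val val' : ℕ} {s σ s' : State} (h : Simulates off R s σ)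
    (hw : w ≤ w') (hval : val = val') (hdst : dst < R) (hs : s.setReg w dst val = some s') :
    ∃ σ', σ.setReg w' dst val' = some σ' ∧ Simulates off R s' σ' ∧
      ∀ v, R ≤ v → σ'.reg v = σ.reg v := by
  subst hval
  unfold State.setReg at hs ⊢
  split_ifs at hs with hlt
  obtain rfl := Option.some.inj hs
  rw [if_pos (hlt.trans_le (Nat.pow_le_pow_right (by omega) hw))]
  refine ⟨_, rfl, ⟨by simp only [h.pc]; omega, h.mem, fun v hv => ?_⟩, fun v hv => ?_⟩
  · by_cases hvd : v = dst
    · subst hvd; simp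
    · simp [Function.update_of_ne hvd, h.reg v hv]
  · exact Function.update_of_ne (by omega) ..

theorem Simulates.step {off next R w w' : ℕ} {P Q : Program} {s σ s' : State}
    (h : Simulates off R s σ) (hw : w ≤ w') (hP : ∀ I ∈ P, I.RegsLt R)
    (hQ : CodeAt Q off (P.map (Instr.relocate off next))) (hs : step w P s = some s') :
    ∃ σ', WordRAM.step w' Q σ = some σ' ∧ Simulates off R s' σ' ∧
      ∀ v, R ≤ v → σ'.reg v = σ.reg v := by
  unfold WordRAM.step at hs ⊢
  rcases hI : P[s.pc]? with _ | I
  · rw [hI] at hs; cases hs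
  have hlt : s.pc < P.length := (List.getElem?_eq_some_iff.1 hI).1
  have hmem : I ∈ P := List.mem_of_getElem? hI
  have hI' : Q[σ.pc]? = some (I.relocate off next) := by
    rw [h.pc, add_comm, hQ.getElem? (by simpa using hlt), List.getElem?_map, hI]; rfl
  have hR := hP I hmem
  rw [hI] at hs
  rw [hI']
  cases I with
  | const dst v => exact h.setReg hw rfl hR hs
  | op o dst a b =>
    exact h.setReg hw (by rw [h.reg a hR.2.1, h.reg b hR.2.2]) hR.1 hs
  | load dst addr => exact h.setReg hw (by rw [h.mem, h.reg addr hR.2]) hR.1 hs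
  | store addr src =>
    obtain rfl := Option.some.inj hs
    refine ⟨_, rfl, ⟨by simp only [h.pc]; omega, ?_, h.reg⟩, fun _ _ => rfl⟩
    simp only [h.mem, h.reg addr hR.1, h.reg src hR.2]
  | jump target =>
    obtain rfl := Option.some.inj hs
    exact ⟨_, rfl, ⟨rfl, h.mem, h.reg⟩, fun _ _ => rfl⟩
  | jumpIfZero a target =>
    obtain rfl := Option.some.inj hs
    refine ⟨_, rfl, ⟨?_, h.mem, h.reg⟩, fun _ _ => rfl⟩
    simp only [h.reg a hR, h.pc]
    split <;> omega
  | halt => cases hs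

/-- A run of a program is reproduced inside a larger program, where the words may be longer, since
a value that fits into a short word fits into a long one. -/
theorem Simulates.run {off next R w w' t : ℕ} {P Q : Program} {s σ s' : State}
    (h : Simulates off R s σ) (hw : w ≤ w') (hP : ∀ I ∈ P, I.RegsLt R)
    (hQ : CodeAt Q off (P.map (Instr.relocate off next))) (hs : run w P t s = some s') :
    ∃ σ', WordRAM.run w' Q t σ = some σ' ∧ Simulates off R s' σ' ∧
      ∀ v, R ≤ v → σ'.reg v = σ.reg v := by
  induction t generalizing s σ with
  | zero =>
    obtain rfl := Option.some.inj hs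
    exact ⟨σ, rfl, h, fun _ _ => rfl⟩
  | succ t ih =>
    rw [WordRAM.run] at hs
    obtain ⟨s₁, h₁, h₂⟩ := Option.bind_eq_some_iff.1 hs
    obtain ⟨σ₁, hσ₁, hsim₁, hr₁⟩ := h.step hw hP hQ h₁
    obtain ⟨σ₂, hσ₂, hsim₂, hr₂⟩ := ih hsim₁ h₂
    refine ⟨σ₂, ?_, hsim₂, fun v hv => (hr₂ v hv).trans (hr₁ v hv)⟩
    rw [WordRAM.run, hσ₁]
    exact hσ₂

/-! ### Filling the memory -/

/-- The memory `mem` with the values of `F` in the cells from `i` to `N - 1`. -/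
def fill (mem F : ℕ → ℕ) (N i : ℕ) : ℕ → ℕ := fun j => if i ≤ j ∧ j < N then F j else mem j

theorem fill_self (mem F : ℕ → ℕ) (N : ℕ) : fill mem F N N = mem := by
  funext j
  rw [fill, if_neg (by omega)]

theorem update_fill (mem F : ℕ → ℕ) {N i : ℕ} (hi : i < N) :
    Function.update (fill mem F N (i + 1)) i (F i) = fill mem F N i := by
  funext j
  by_cases hj : j = i
  · subst hj; simp [fill, hi]
  · rw [Function.update_of_ne hj]
    unfold fill
    congr 1
    simp only [eq_iff_iff]
    omega

/-- The loop at number `pos` that writes the value of `E` to the cells `N - 1, …, 0`, in this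
order, where register `R` holds the number of cells left, and `E` finds the address in register
`R + 1`. -/
def fillLoop (pos R : ℕ) (E : Expr) : List Instr :=
  let body := (Expr.op .sub (.var R) (.const 1)).compile (R + 1) ++ (E.compile (R + 2) ++
    [.store (R + 1) (R + 2), .op .or R (R + 1) (R + 1), .jump pos])
  .jumpIfZero R (pos + 1 + body.length) :: body

/-- The loop writes the values of `F` if, for each address `i`, the expression `E` has the value `F
i` at the time when the cells above `i` have been overwritten and those up to `i` have not. -/
theorem run_fillLoop {w pos R B N i : ℕ} {E : Expr} {Q : Program} {reg mem F : ℕ → ℕ} {s : State}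
    (hB : 2 ≤ B) (hE : E.Tame (R + 2) B) (hw : B ^ E.size < 2 ^ w) (hw' : B ^ 2 < 2 ^ w)
    (hQ : CodeAt Q pos (fillLoop pos R E)) (hpc : s.pc = pos) (hi : s.reg R = i) (hiN : i ≤ N)
    (hN : N ≤ B) (hreg : ∀ v < R, s.reg v = reg v) (hregB : ∀ v < R, reg v ≤ B)
    (hmem : s.mem = fill mem F N i) (hmemB : ∀ i, mem i ≤ B) (hF : ∀ i < N, F i ≤ B)
    (hval : ∀ i < N, ∀ reg' : ℕ → ℕ, (∀ v < R, reg' v = reg v) → reg' (R + 1) = i →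
      E.eval reg' (fill mem F N (i + 1)) = F i) :
    ∃ s', run w Q (i * (fillLoop pos R E).length + 1) s = some s' ∧
      s'.pc = pos + (fillLoop pos R E).length ∧ (∀ v < R, s'.reg v = reg v) ∧
      s'.mem = fill mem F N 0 := by
  have hfillB : ∀ i j, fill mem F N i j ≤ B := by
    intro i j
    unfold fill
    split
    · exact hF j (by omega)
    · exact hmemB j
  induction i generalizing s with
  | zero =>
    refine ⟨⟨pos + (fillLoop pos R E).length, s.reg, s.mem⟩, ?_, rfl, hreg, hmem⟩
    rw [Nat.zero_mul, zero_add]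
    refine run_one ?_
    rw [step, hpc, hQ.head]
    simp only [hi, if_true, fillLoop, List.length_cons, add_assoc, add_comm 1]
  | succ i ih =>
    -- test, and compute the address
    obtain ⟨s₀, hs₀, hpc₀, hr₀, hm₀⟩ : ∃ s₀, run w Q 1 s = some s₀ ∧ s₀.pc = pos + 1 ∧
        s₀.reg = s.reg ∧ s₀.mem = s.mem := by
      refine ⟨⟨pos + 1, s.reg, s.mem⟩, run_one ?_, rfl, rfl, rfl⟩
      rw [step, hpc, hQ.head]
      simp [hi]
    have hQ' := CodeAt.right (c₁ := [_]) hQ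
    simp only [List.length_singleton] at hQ'
    have hregs : ∀ v < R + 1, s.reg v ≤ B := by
      intro v hv
      rcases Nat.lt_succ_iff_lt_or_eq.1 hv with hv | rfl
      · rw [hreg v hv]; exact hregB v hv
      · omega
    obtain ⟨s₁, hs₁, hpc₁, hm₁, hv₁, hr₁⟩ := Expr.run_compile (w := w) (Q := Q) (k := R + 1)
      (B := B) (dst := R + 1) (e := .op .sub (.var R) (.const 1)) (s := s₀) hB
      (by rw [hr₀]; exact hregs) (by rw [hm₀, hmem]; exact hfillB _)
      ⟨by simp, Nat.lt_succ_self R, (by omega : 1 ≤ B)⟩ le_rfl hw' (by rw [hpc₀]; exact hQ'.left)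
    have hv₁' : s₁.reg (R + 1) = i := by
      rw [hv₁, hr₀]; simp [Expr.eval, BinOp.eval, hi]
    have hr₁' : ∀ v < R + 1, s₁.reg v = s.reg v := fun v hv => by rw [hr₁ v hv, hr₀]
    have hm₁' : s₁.mem = fill mem F N (i + 1) := by rw [hm₁, hm₀, hmem]
    -- compute the value
    obtain ⟨s₂, hs₂, hpc₂, hm₂, hv₂, hr₂⟩ := Expr.run_compile (w := w) (Q := Q) (k := R + 2)
      (B := B) (dst := R + 2) (e := E) (s := s₁) hB
      (by
        intro v hv
        rcases Nat.lt_succ_iff_lt_or_eq.1 hv with hv | rfl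
        · rw [hr₁' v hv]; exact hregs v hv
        · omega) (by rw [hm₁']; exact hfillB _)
      hE le_rfl hw (by rw [hpc₁, hpc₀]; exact hQ'.right.left)
    have hv₂' : s₂.reg (R + 2) = F i := by
      rw [hv₂, hm₁']
      exact hval i (by omega) _ (fun v hv => (hr₁' v (by omega)).trans (hreg v hv)) hv₁'
    have ha₂ : s₂.reg (R + 1) = i := by rw [hr₂ _ (by omega), hv₁']
    have hQ₂ : CodeAt Q s₂.pc [.store (R + 1) (R + 2), .op .or R (R + 1) (R + 1), .jump pos] := by
      rw [hpc₂, hpc₁, hpc₀]; exact hQ'.right.right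
    -- write, and go back
    obtain ⟨s₃, hs₃, hpc₃, hr₃, hm₃⟩ : ∃ s₃, run w Q 3 s₂ = some s₃ ∧ s₃.pc = pos ∧
        s₃.reg = Function.update s₂.reg R i ∧ s₃.mem = fill mem F N i := by
      have h₁ := hQ₂.getElem? (i := 0) (by simp)
      have h₂ := hQ₂.getElem? (i := 1) (by simp)
      have h₃ := hQ₂.getElem? (i := 2) (by simp)
      have hi2 : i < 2 ^ w := by
        have := Nat.le_self_pow (n := 2) (by omega) B
        omega
      refine ⟨⟨pos, Function.update s₂.reg R i, fill mem F N i⟩, ?_, rfl, rfl, rfl⟩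
      simp only [add_zero, List.getElem?_cons_zero, List.getElem?_cons_succ] at h₁ h₂ h₃
      simp only [run, step, h₁, Option.bind_some, h₂, State.setReg, BinOp.eval, Nat.or_self, ha₂,
        if_pos hi2, h₃, hv₂', hm₂, hm₁', update_fill mem F (show i < N by omega)]
    obtain ⟨s₄, hs₄, hpc₄, hr₄, hm₄⟩ := ih (s := s₃) hpc₃ (by rw [hr₃]; simp) (by omega)
      (by
        intro v hv
        rw [hr₃, Function.update_of_ne (by omega), hr₂ v (by omega), hr₁' v (by omega), hreg v hv])
      hm₃
    refine ⟨s₄, ?_, hpc₄, hr₄, hm₄⟩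
    have hlen : (i + 1) * (fillLoop pos R E).length + 1 =
        1 + (((Expr.op .sub (.var R) (.const 1)).compile (R + 1)).length +
          ((E.compile (R + 2)).length + (3 + (i * (fillLoop pos R E).length + 1)))) := by
      simp only [fillLoop, List.length_cons, List.length_append, List.length_nil]
      ring
    rw [hlen]
    exact run_trans hs₀ (run_trans hs₁ (run_trans hs₂ (run_trans hs₃ hs₄)))

end WordRAM

/-! ### The symbols of the sequences -/

theorem List.getElem?_flatten_of_length {α : Type*} {U : ℕ} {l : List (List α)}
    (hl : ∀ s ∈ l, s.length = U) (u : ℕ) {o : ℕ} (ho : o < U) :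
    l.flatten[u * U + o]? = l[u]?.bind fun s => s[o]? := by
  induction l generalizing u with
  | nil => simp
  | cons s l ih =>
    have hs := hl s (by simp)
    cases u with
    | zero => rw [List.flatten_cons, List.getElem?_append_left (by omega)]; simp
    | succ u =>
      rw [List.flatten_cons, List.getElem?_append_right (by rw [hs]; nlinarith), hs,
        show (u + 1) * U + o - U = u * U + o by rw [add_mul]; omega,
        ih fun s hs => hl s (by simp [hs])]
      simp

theorem getElem?_leftBlock {K j : ℕ} (a : Bool) (hj : j < 2 * K + 2) :
    (leftBlock K a)[j]? = some (if j < K then 2 else if j < K + 1 then (bif a then 0 else 2)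
      else if j < K + 2 then 1 else 3) := by
  unfold leftBlock
  split_ifs with h₁ h₂ h₃
  · rw [List.getElem?_append_left (by simpa using h₁)]; simp [h₁]
  · obtain rfl : j = K := by omega
    rw [List.getElem?_append_right (by simp)]; simp
  · obtain rfl : j = K + 1 := by omega
    rw [List.getElem?_append_right (by simp)]; simp
  · obtain ⟨i, rfl⟩ := Nat.exists_eq_add_of_le (not_lt.1 h₃)
    rw [List.getElem?_append_right (by simp; omega), List.length_replicate,
      show K + 2 + i - K = i + 1 + 1 by omega]
    simp only [List.getElem?_cons_succ, List.getElem?_replicate]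
    rw [if_pos (by omega)]

/-- The last two cases agree; they are kept apart to match `symbolAt`, which serves both
sequences. -/
theorem getElem?_rightBlock {K j : ℕ} (b : Bool) (hj : j < 2 * K + 2) :
    (rightBlock K b)[j]? = some (if j < K then 2 else if j < K + 1 then (bif b then 2 else 0)
      else if j < K + 2 then 3 else 3) := by
  unfold rightBlock
  split_ifs with h₁ h₂
  · rw [List.getElem?_append_left (by simpa using h₁)]; simp [h₁]
  · obtain rfl : j = K := by omega
    rw [List.getElem?_append_right (by simp)]; simp
  all_goals
    obtain ⟨i, rfl⟩ := Nat.exists_eq_add_of_le (not_lt.1 h₂)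
    rw [List.getElem?_append_right (by simp; omega), List.length_replicate,
      show K + 1 + i - K = i + 1 by omega]
    simp only [List.getElem?_cons_succ, List.getElem?_replicate]
    rw [if_pos (by omega)]

/-- Position `p` of one of the sequences lies in the unit of this index, where a unit is a
separator with the gadget that follows it. -/
def unitIndex (d r p : ℕ) : ℕ := p / (4 * gadgetLength d r)

/-- The offset of position `p` in its gadget. -/
def gadgetOffset (d r p : ℕ) : ℕ := p % (4 * gadgetLength d r) - 3 * gadgetLength d r

/-- The coordinate that position `p` belongs to. -/
def coordIndex (d r p : ℕ) : ℕ := gadgetOffset d r p / (2 * (2 * (d + r + 1)) + 2)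

/-- The offset of position `p` in the block of its coordinate. -/
def blockOffset (d r p : ℕ) : ℕ := gadgetOffset d r p % (2 * (2 * (d + r + 1)) + 2)

/-- The symbol at position `p`, if `s₀` and `s₁` are the symbols after the first run of a block. -/
def symbolAt (d r s₀ s₁ p : ℕ) : ℕ :=
  if p % (4 * gadgetLength d r) < 3 * gadgetLength d r then 4
  else if blockOffset d r p < 2 * (d + r + 1) then 2
  else if blockOffset d r p < 2 * (d + r + 1) + 1 then s₀
  else if blockOffset d r p < 2 * (d + r + 1) + 2 then s₁
  else 3

/-- Coordinate `h` of the vector of unit `u` of the first sequence. -/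
def unitBits {n d : ℕ} (α : Fin n → Fin d → Fin 2) (u h : ℕ) : Bool :=
  if u < n then decide (d ≤ h) else if u < 2 * n then natBits α (u - n) h else decide (d ≤ h)

theorem gadgetLength_pos (d r : ℕ) : 0 < gadgetLength d r := by unfold gadgetLength; positivity

theorem getElem?_separated {L p : ℕ} {l : List (List (Fin 5))} (hl : ∀ A ∈ l, A.length = L)
    (hL : 0 < L) : (separated (3 * L) l)[p]? = l[p / (4 * L)]?.bind fun A =>
      if p % (4 * L) < 3 * L then some 4 else A[p % (4 * L) - 3 * L]? := by
  have h := List.getElem?_flatten_of_length (U := 4 * L)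
    (l := l.map fun A => List.replicate (3 * L) 4 ++ A)
    (by
      intro s hs
      obtain ⟨A, hA, rfl⟩ := List.mem_map.1 hs
      have := hl A hA
      simp; omega) (p / (4 * L)) (Nat.mod_lt p (by omega))
  rw [Nat.div_add_mod', ← List.flatMap_def] at h
  rw [separated, h, List.getElem?_map, Option.bind_map]
  congr 1
  funext A
  simp only [Function.comp]
  split_ifs with hp
  · rw [List.getElem?_append_left (by simpa using hp)]; simp [hp]
  · rw [List.getElem?_append_right (by simpa using hp)]; simp

theorem getElem?_flatMap_range {α : Type*} {f : ℕ → List α} {m P q : ℕ}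
    (hf : ∀ i, (f i).length = P) (hq : q < m * P) :
    ((List.range m).flatMap f)[q]? = (f (q / P))[q % P]? := by
  have hP : 0 < P := Nat.pos_of_ne_zero (by rintro rfl; simp at hq)
  have h := List.getElem?_flatten_of_length (U := P) (l := (List.range m).map f)
    (by
      intro s hs
      obtain ⟨i, -, rfl⟩ := List.mem_map.1 hs
      exact hf i) (q / P) (Nat.mod_lt q hP)
  rw [Nat.div_add_mod', ← List.flatMap_def] at h
  rw [h, List.getElem?_map, List.getElem?_range (Nat.div_lt_of_lt_mul (by rwa [mul_comm]))]
  rfl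

theorem length_separated {M L : ℕ} {l : List (List (Fin 5))} (hl : ∀ A ∈ l, A.length = L) :
    (separated M l).length = l.length * (M + L) := by
  induction l with
  | nil => simp [separated]
  | cons A l ih =>
    rw [separated_cons, List.length_append, List.length_append, List.length_replicate,
      hl A (by simp), ih fun A hA => hl A (by simp [hA]), List.length_cons]
    ring

theorem length_of_mem_withDummies {n d r : ℕ} {α : Fin n → Fin d → Fin 2} {A : List (Fin 5)}
    (hA : A ∈ withDummies (dummyGadget d r) (leftGadgets α r)) : A.length = gadgetLength d r := by
  simp only [withDummies, List.mem_append, List.mem_replicate, leftGadgets, List.mem_map] at hA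
  rcases hA with ⟨-, rfl⟩ | ⟨i, -, rfl⟩ | ⟨-, rfl⟩ <;> exact length_leftGadget _ _ _

theorem length_of_mem_rightGadgets {n d r : ℕ} {β : Fin n → Fin d → Fin 2} {B : List (Fin 5)}
    (hB : B ∈ rightGadgets β r) : B.length = gadgetLength d r := by
  obtain ⟨j, -, rfl⟩ := List.mem_map.1 hB
  exact length_rightGadget _ _ _

theorem length_separated_left {n d : ℕ} (α : Fin n → Fin d → Fin 2) (r : ℕ) :
    (separated (3 * gadgetLength d r) (withDummies (dummyGadget d r) (leftGadgets α r))).length =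
      3 * n * (4 * gadgetLength d r) := by
  rw [length_separated fun A => length_of_mem_withDummies]
  simp only [withDummies, leftGadgets, List.length_append, List.length_replicate, List.length_map,
    List.length_range]
  ring

theorem length_separated_right {n d : ℕ} (β : Fin n → Fin d → Fin 2) (r : ℕ) :
    (separated (3 * gadgetLength d r) (rightGadgets β r)).length =
      n * (4 * gadgetLength d r) := by
  rw [length_separated fun A => length_of_mem_rightGadgets]
  simp only [rightGadgets, List.length_map, List.length_range]
  ring

theorem length_leftSeq {n d : ℕ} (α : Fin n → Fin d → Fin 2) (r : ℕ) :
    (leftSeq α r).length = seqLength n d r := by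
  rw [leftSeq, List.length_append, length_separated_left, seqLength, List.length_singleton]

theorem length_rightSeq {n d : ℕ} (β : Fin n → Fin d → Fin 2) (r : ℕ) :
    (rightSeq β r).length = seqLength n d r := by
  rw [rightSeq, List.length_append, length_separated_right, seqLength, List.length_replicate]
  ring

theorem gadgetOffset_lt {d r p : ℕ} (hp : ¬ p % (4 * gadgetLength d r) < 3 * gadgetLength d r) :
    gadgetOffset d r p < (d + r + 1) * (2 * (2 * (d + r + 1)) + 2) := by
  have := Nat.mod_lt p (y := 4 * gadgetLength d r) (by have := gadgetLength_pos d r; omega)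
  have h : gadgetOffset d r p < gadgetLength d r := by unfold gadgetOffset; omega
  exact h

/-- The symbols of the first sequence in the closed form that the program evaluates. -/
theorem val_leftSeq {n d r p : ℕ} (α : Fin n → Fin d → Fin 2) (hp : p < seqLength n d r) :
    ((leftSeq α r).getD p 0).val = symbolAt d r
      (2 - 2 * (unitBits α (unitIndex d r p) (coordIndex d r p)).toNat) 1 p := by
  have hL := gadgetLength_pos d r
  have hlen := length_separated_left α r
  rw [List.getD_eq_getElem?_getD, leftSeq]
  unfold seqLength at hp
  rcases Nat.lt_succ_iff_lt_or_eq.1 hp with hp | rfl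
  · have hu : unitIndex d r p < 3 * n := Nat.div_lt_of_lt_mul (by rwa [mul_comm])
    have hunit : (withDummies (dummyGadget d r) (leftGadgets α r))[unitIndex d r p]? =
        some (leftGadget (2 * (d + r + 1)) (d + r + 1) (unitBits α (unitIndex d r p))) := by
      generalize unitIndex d r p = u at hu ⊢
      have hn : (leftGadgets α r).length = n := by simp [leftGadgets]
      rw [withDummies, hn]
      rcases lt_or_ge u n with h₁ | h₁
      · rw [List.getElem?_append_left (by simpa using h₁)]
        have : unitBits α u = fun h => decide (d ≤ h) := by
          funext h; simp [unitBits, h₁]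
        simp [h₁, this, dummyGadget]
      rw [List.getElem?_append_right (by simpa using h₁), List.length_replicate]
      rcases lt_or_ge u (2 * n) with h₂ | h₂
      · rw [List.getElem?_append_left (by rw [hn]; omega)]
        have : unitBits α u = natBits α (u - n) := by
          funext h; simp [unitBits, not_lt.2 h₁, h₂]
        rw [this, leftGadgets, List.getElem?_map, List.getElem?_range (by omega)]
        rfl
      · rw [List.getElem?_append_right (by rw [hn]; omega), hn]
        have : unitBits α u = fun h => decide (d ≤ h) := by
          funext h; simp [unitBits, not_lt.2 h₁, not_lt.2 h₂]
        rw [List.getElem?_replicate, if_pos (by omega), this, dummyGadget]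
    rw [List.getElem?_append_left (by rwa [hlen]), getElem?_separated
      (fun A => length_of_mem_withDummies) hL, ← unitIndex, hunit, Option.bind_some, symbolAt]
    split_ifs with h₀
    · rfl
    all_goals
      have hq := gadgetOffset_lt h₀
      rw [← gadgetOffset, leftGadget, getElem?_flatMap_range (P := 2 * (2 * (d + r + 1)) + 2)
        (fun i => length_leftBlock _ _) hq, getElem?_leftBlock _ (Nat.mod_lt _ (by omega)),
        ← blockOffset, ← coordIndex]
      simp only [*, if_true, if_false, Option.getD_some]
      try rfl
    cases unitBits α (unitIndex d r p) (coordIndex d r p) <;> rfl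
  · rw [List.getElem?_append_right (by rw [hlen]), hlen, symbolAt, if_pos (by simp; omega)]
    simp

/-- The symbols of the second sequence in the closed form that the program evaluates. -/
theorem val_rightSeq {n d r p : ℕ} (β : Fin n → Fin d → Fin 2) (hp : p < seqLength n d r) :
    ((rightSeq β r).getD p 0).val = if unitIndex d r p < n then symbolAt d r
      (2 * (natBits β (unitIndex d r p) (coordIndex d r p) ||
        decide (d ≤ coordIndex d r p)).toNat) 3 p else 4 := by
  have hL := gadgetLength_pos d r
  have hlen := length_separated_right β r
  rw [List.getD_eq_getElem?_getD, rightSeq]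
  unfold seqLength at hp
  split_ifs with hu
  · have hp' : p < n * (4 * gadgetLength d r) := by
      rw [mul_comm]; exact (Nat.div_lt_iff_lt_mul (by omega)).1 hu |>.trans_eq (mul_comm _ _)
    rw [List.getElem?_append_left (by rwa [hlen]), getElem?_separated
      (fun A => length_of_mem_rightGadgets) hL, ← unitIndex,
      rightGadgets, List.getElem?_map, List.getElem?_range hu, Option.map_some, Option.bind_some,
      symbolAt]
    split_ifs with h₀
    · rfl
    all_goals
      have hq := gadgetOffset_lt h₀
      rw [← gadgetOffset, rightGadget, getElem?_flatMap_range (P := 2 * (2 * (d + r + 1)) + 2)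
        (fun i => length_rightBlock _ _) hq, getElem?_rightBlock _ (Nat.mod_lt _ (by omega)),
        ← blockOffset, ← coordIndex]
      simp only [*, if_true, if_false, Option.getD_some]
      try rfl
    cases (natBits β (unitIndex d r p) (coordIndex d r p) || decide (d ≤ coordIndex d r p)) <;> rfl
  · have hp' : n * (4 * gadgetLength d r) ≤ p :=
      (Nat.le_div_iff_mul_le (by omega)).1 (not_lt.1 hu)
    have h : 3 * n * (4 * gadgetLength d r) = n * (4 * gadgetLength d r) +
      2 * n * (4 * gadgetLength d r) := by ring
    rw [List.getElem?_append_right (by rwa [hlen]), hlen, List.getElem?_replicate,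
      if_pos (by omega)]
    rfl

/-! ### The encodings -/

theorem getElem?_flatten_ofFn {n d : ℕ} (α : Fin n → Fin d → Fin 2) {i h : ℕ} (hi : i < n)
    (hh : h < d) : (List.ofFn fun i => List.ofFn fun h => (α i h).val).flatten[i * d + h]? =
      some (natBits α i h).toNat := by
  rw [List.getElem?_flatten_of_length (by
    intro s hs
    obtain ⟨i, rfl⟩ := List.mem_ofFn.1 hs
    simp) i hh]
  simp only [List.getElem?_ofFn, hi, hh, dif_pos, Option.bind_some, natBits, and_self]
  generalize α ⟨i, hi⟩ ⟨h, hh⟩ = a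
  revert a
  decide

theorem length_flatten_ofFn {n d : ℕ} (α : Fin n → Fin d → Fin 2) :
    (List.ofFn fun i => List.ofFn fun h => (α i h).val).flatten.length = n * d := by
  simp [List.length_flatten, List.map_ofFn, Function.comp_def]

theorem length_encodeVectors {n d : ℕ} (α β : Fin n → Fin d → Fin 2) (r : ℕ) :
    (encodeVectors α β r).length = 3 + 2 * (n * d) := by
  simp only [encodeVectors, List.length_cons, List.length_append, length_flatten_ofFn]; omega

theorem getD_encodeVectors_left {n d : ℕ} (α β : Fin n → Fin d → Fin 2) (r : ℕ) {i h : ℕ}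
    (hi : i < n) (hh : h < d) :
    (encodeVectors α β r).getD (3 + (i * d + h)) 0 = (natBits α i h).toNat := by
  have hlt : i * d + h < n * d := by nlinarith
  rw [List.getD_eq_getElem?_getD, encodeVectors, add_comm 3]
  simp only [List.getElem?_cons_succ]
  rw [List.getElem?_append_left (by rwa [length_flatten_ofFn]), getElem?_flatten_ofFn α hi hh]
  rfl

theorem getD_encodeVectors_right {n d : ℕ} (α β : Fin n → Fin d → Fin 2) (r : ℕ) {j h : ℕ}
    (hj : j < n) (hh : h < d) :
    (encodeVectors α β r).getD (3 + (n * d + (j * d + h))) 0 = (natBits β j h).toNat := by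
  rw [List.getD_eq_getElem?_getD, encodeVectors, add_comm 3]
  simp only [List.getElem?_cons_succ]
  rw [List.getElem?_append_right (by rw [length_flatten_ofFn]; omega), length_flatten_ofFn,
    Nat.add_sub_cancel_left, getElem?_flatten_ofFn β hj hh]
  rfl

/-- The first sequence as a function of the position. -/
def leftFun {n d : ℕ} (α : Fin n → Fin d → Fin 2) (r : ℕ) : Fin (seqLength n d r) → Fin 5 :=
  fun p => (leftSeq α r).getD p 0

/-- The second sequence as a function of the position. -/
def rightFun {n d : ℕ} (β : Fin n → Fin d → Fin 2) (r : ℕ) : Fin (seqLength n d r) → Fin 5 :=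
  fun p => (rightSeq β r).getD p 0

theorem List.ofFn_getD {S : Type*} {N : ℕ} (l : List S) (h : l.length = N) (a : S) :
    List.ofFn (fun p : Fin N => l.getD p a) = l := by
  subst h
  refine List.ext_getElem (by simp) fun i h₁ h₂ => ?_
  simp

theorem ofFn_leftFun {n d : ℕ} (α : Fin n → Fin d → Fin 2) (r : ℕ) :
    List.ofFn (leftFun α r) = leftSeq α r := List.ofFn_getD _ (length_leftSeq α r) 0

theorem ofFn_rightFun {n d : ℕ} (β : Fin n → Fin d → Fin 2) (r : ℕ) :
    List.ofFn (rightFun β r) = rightSeq β r := List.ofFn_getD _ (length_rightSeq β r) 0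

theorem length_encodeSequences {σ N : ℕ} (x y : Fin N → Fin σ) :
    (encodeSequences x y).length = 2 * N + 1 := by
  simp [encodeSequences]; omega

theorem getD_encodeSequences {σ N : ℕ} (x y : Fin N → Fin σ) (p : Fin N) :
    (encodeSequences x y).getD (p + 1) 0 = (x p).val ∧
      (encodeSequences x y).getD (p + 1 + N) 0 = (y p).val := by
  constructor
  · rw [List.getD_eq_getElem?_getD, encodeSequences, List.getElem?_cons_succ,
      List.getElem?_append_left (by simp)]
    simp
  · rw [List.getD_eq_getElem?_getD, encodeSequences, add_right_comm, List.getElem?_cons_succ,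
      List.getElem?_append_right (by simp)]
    simp

namespace WordRAM

/-! ### The sequences as expressions -/

namespace Expr

instance : Add Expr := ⟨op .add⟩
instance : Sub Expr := ⟨op .sub⟩
instance : Mul Expr := ⟨op .mul⟩
instance : Div Expr := ⟨op .div⟩
instance : Mod Expr := ⟨op .mod⟩
instance (c : ℕ) : OfNat Expr c := ⟨const c⟩

theorem eval_add (reg mem : ℕ → ℕ) (a b : Expr) :
    (a + b).eval reg mem = a.eval reg mem + b.eval reg mem := rfl

theorem eval_sub (reg mem : ℕ → ℕ) (a b : Expr) :
    (a - b).eval reg mem = a.eval reg mem - b.eval reg mem := rfl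

theorem eval_mul (reg mem : ℕ → ℕ) (a b : Expr) :
    (a * b).eval reg mem = a.eval reg mem * b.eval reg mem := rfl

theorem eval_ofNat (reg mem : ℕ → ℕ) (c : ℕ) :
    (OfNat.ofNat c : Expr).eval reg mem = OfNat.ofNat c := rfl

theorem eval_load (reg mem : ℕ → ℕ) (a : Expr) :
    (load a).eval reg mem = mem (a.eval reg mem) := rfl

section Tame

variable {k B : ℕ} {a b : Expr}

theorem Tame.add (ha : a.Tame k B) (hb : b.Tame k B) : (a + b).Tame k B :=
  ⟨.inl rfl, ha, hb⟩

theorem Tame.sub (ha : a.Tame k B) (hb : b.Tame k B) : (a - b).Tame k B :=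
  ⟨.inr (.inl rfl), ha, hb⟩

theorem Tame.mul (ha : a.Tame k B) (hb : b.Tame k B) : (a * b).Tame k B :=
  ⟨.inr (.inr (.inl rfl)), ha, hb⟩

theorem Tame.div (ha : a.Tame k B) (hb : b.Tame k B) : (a / b).Tame k B :=
  ⟨.inr (.inr (.inr (.inl rfl))), ha, hb⟩

theorem Tame.mod (ha : a.Tame k B) (hb : b.Tame k B) : (a % b).Tame k B :=
  ⟨.inr (.inr (.inr (.inr rfl))), ha, hb⟩

theorem Tame.ofNat {c : ℕ} (hc : (OfNat.ofNat c : ℕ) ≤ B) : (OfNat.ofNat c : Expr).Tame k B := hc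

end Tame

/-! The registers `R`, `R + 1`, `R + 2` hold `n`, `d` and `r`. -/

/-- `d + r + 1` -/
def coords (R : ℕ) : Expr := var (R + 1) + var (R + 2) + 1

/-- The expression for `gadgetLength`. -/
def gadgetLen (R : ℕ) : Expr := coords R * (2 * (2 * coords R) + 2)

/-- The expression for `seqLength`. -/
def seqLen (R : ℕ) : Expr := 3 * var R * (4 * gadgetLen R) + 1

/-- The expression for `costThreshold`. -/
def threshold (R : ℕ) : Expr :=
  2 * var R * gadgetLen R + var R * (coords R + (var (R + 2) + 1))

/-- The expression for `unitIndex`. -/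
def unit (R : ℕ) (p : Expr) : Expr := p / (4 * gadgetLen R)

/-- The expression for `gadgetOffset`. -/
def offset (R : ℕ) (p : Expr) : Expr := p % (4 * gadgetLen R) - 3 * gadgetLen R

/-- The expression for `coordIndex`. -/
def coord (R : ℕ) (p : Expr) : Expr := offset R p / (2 * (2 * coords R) + 2)

/-- The expression for `blockOffset`. -/
def blockOff (R : ℕ) (p : Expr) : Expr := offset R p % (2 * (2 * coords R) + 2)

/-- The expression for `symbolAt`. -/
def symbol (R : ℕ) (s₀ s₁ p : Expr) : Expr :=
  ifLt (p % (4 * gadgetLen R)) (3 * gadgetLen R) 4 <|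
  ifLt (blockOff R p) (2 * coords R) 2 <|
  ifLt (blockOff R p) (2 * coords R + 1) s₀ <|
  ifLt (blockOff R p) (2 * coords R + 2) s₁ 3

/-- Coordinate `h` of unit `u` of the first sequence, read from the input. -/
def leftBit (R : ℕ) (u h : Expr) : Expr :=
  ifLt u (var R) (ifLt h (var (R + 1)) 0 1) <|
  ifLt u (2 * var R)
    (ifLt h (var (R + 1)) (load (3 + ((u - var R) * var (R + 1) + h))) 0) <|
  ifLt h (var (R + 1)) 0 1

/-- Coordinate `h` of unit `u` of the second sequence, read from the input. -/
def rightBit (R : ℕ) (u h : Expr) : Expr :=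
  ifLt h (var (R + 1)) (load (3 + (var R * var (R + 1) + (u * var (R + 1) + h)))) 1

/-- The symbol at position `p` of the first sequence. -/
def leftSymbol (R : ℕ) (p : Expr) : Expr :=
  symbol R (2 - 2 * leftBit R (unit R p) (coord R p)) 1 p

/-- The symbol at position `p` of the second sequence. -/
def rightSymbol (R : ℕ) (p : Expr) : Expr :=
  ifLt (unit R p) (var R) (symbol R (2 * rightBit R (unit R p) (coord R p)) 3 p) 4

/-- The word at address `a` of the encoding of the two sequences. -/
def target (R : ℕ) (a : Expr) : Expr :=
  ifLt a 1 (seqLen R) <|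
  ifLt a (seqLen R + 1) (leftSymbol R (a - 1)) (rightSymbol R (a - 1 - seqLen R))

section Tame

variable {R k B : ℕ} {p u h s₀ s₁ : Expr}

theorem tame_coords (hk : R + 3 ≤ k) (hB : 4 ≤ B) : (coords R).Tame k B :=
  .add (.add (by simp only [Tame]; omega) (by simp only [Tame]; omega)) (.ofNat (by omega))

theorem tame_gadgetLen (hk : R + 3 ≤ k) (hB : 4 ≤ B) : (gadgetLen R).Tame k B :=
  have h := tame_coords hk hB
  .mul h (.add (.mul (.ofNat (by omega)) (.mul (.ofNat (by omega)) h)) (.ofNat (by omega)))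

theorem tame_var {v : ℕ} (hv : v < k) : (var v).Tame k B := hv

theorem tame_seqLen (hk : R + 3 ≤ k) (hB : 4 ≤ B) : (seqLen R).Tame k B :=
  .add (.mul (.mul (.ofNat (by omega)) (tame_var (by omega)))
    (.mul (.ofNat (by omega)) (tame_gadgetLen hk hB))) (.ofNat (by omega))

theorem tame_threshold (hk : R + 3 ≤ k) (hB : 4 ≤ B) : (threshold R).Tame k B :=
  .add (.mul (.mul (.ofNat (by omega)) (tame_var (by omega))) (tame_gadgetLen hk hB))
    (.mul (tame_var (by omega)) (.add (tame_coords hk hB)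
      (.add (tame_var (by omega)) (.ofNat (by omega)))))

theorem tame_unit (hk : R + 3 ≤ k) (hB : 4 ≤ B) (hp : p.Tame k B) : (unit R p).Tame k B :=
  .div hp (.mul (.ofNat (by omega)) (tame_gadgetLen hk hB))

theorem tame_offset (hk : R + 3 ≤ k) (hB : 4 ≤ B) (hp : p.Tame k B) : (offset R p).Tame k B :=
  .sub (.mod hp (.mul (.ofNat (by omega)) (tame_gadgetLen hk hB)))
    (.mul (.ofNat (by omega)) (tame_gadgetLen hk hB))

theorem tame_coord (hk : R + 3 ≤ k) (hB : 4 ≤ B) (hp : p.Tame k B) : (coord R p).Tame k B :=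
  .div (tame_offset hk hB hp) (.add (.mul (.ofNat (by omega)) (.mul (.ofNat (by omega))
    (tame_coords hk hB))) (.ofNat (by omega)))

theorem tame_blockOff (hk : R + 3 ≤ k) (hB : 4 ≤ B) (hp : p.Tame k B) :
    (blockOff R p).Tame k B :=
  .mod (tame_offset hk hB hp) (.add (.mul (.ofNat (by omega)) (.mul (.ofNat (by omega))
    (tame_coords hk hB))) (.ofNat (by omega)))

theorem tame_symbol (hk : R + 3 ≤ k) (hB : 4 ≤ B) (hp : p.Tame k B) (h₀ : s₀.Tame k B)
    (h₁ : s₁.Tame k B) : (symbol R s₀ s₁ p).Tame k B := by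
  have hL := tame_gadgetLen hk hB
  have h2 : (2 : Expr).Tame k B := .ofNat (by omega)
  have hK := h2.mul (tame_coords hk hB)
  have hj := tame_blockOff hk hB hp
  have hB' : 1 ≤ B := by omega
  exact tame_ifLt hB' (.mod hp (.mul (.ofNat (by omega)) hL)) (.mul (.ofNat (by omega)) hL)
    (.ofNat (by omega)) (tame_ifLt hB' hj hK (.ofNat (by omega))
      (tame_ifLt hB' hj (.add hK (.ofNat (by omega))) h₀
        (tame_ifLt hB' hj (.add hK (.ofNat (by omega))) h₁ (.ofNat (by omega)))))

theorem tame_leftBit (hk : R + 3 ≤ k) (hB : 4 ≤ B) (hu : u.Tame k B) (hh : h.Tame k B) :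
    (leftBit R u h).Tame k B := by
  have hn : (var R).Tame k B := tame_var (by omega)
  have hd : (var (R + 1)).Tame k B := tame_var (by omega)
  have hB' : 1 ≤ B := by omega
  have h0 : (0 : Expr).Tame k B := .ofNat (by omega)
  have h1 : (1 : Expr).Tame k B := .ofNat (by omega)
  have hdummy := tame_ifLt hB' hh hd h0 h1
  have haddr : Tame k B (3 + ((u - var R) * var (R + 1) + h)) :=
    .add (.ofNat (by omega)) (.add (.mul (.sub hu hn) hd) hh)
  exact tame_ifLt hB' hu hn hdummy (tame_ifLt hB' hu (.mul (.ofNat (by omega)) hn)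
    (tame_ifLt hB' hh hd haddr (.ofNat (by omega))) hdummy)

theorem tame_rightBit (hk : R + 3 ≤ k) (hB : 4 ≤ B) (hu : u.Tame k B) (hh : h.Tame k B) :
    (rightBit R u h).Tame k B := by
  have hn : (var R).Tame k B := tame_var (by omega)
  have hd : (var (R + 1)).Tame k B := tame_var (by omega)
  have haddr : Tame k B (3 + (var R * var (R + 1) + (u * var (R + 1) + h))) :=
    .add (.ofNat (by omega)) (.add (.mul hn hd) (.add (.mul hu hd) hh))
  exact tame_ifLt (by omega) hh hd haddr (.ofNat (by omega))

theorem tame_target (hk : R + 3 ≤ k) (hB : 4 ≤ B) (hp : p.Tame k B) : (target R p).Tame k B := by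
  have hn : (var R).Tame k B := tame_var (by omega)
  have hN := tame_seqLen hk hB
  have hB' : 1 ≤ B := by omega
  have h1 : (1 : Expr).Tame k B := .ofNat (by omega)
  have h2 : (2 : Expr).Tame k B := .ofNat (by omega)
  have hl := hp.sub h1
  have hr := hl.sub hN
  exact tame_ifLt hB' hp h1 hN (tame_ifLt hB' hp (.add hN h1)
    (tame_symbol hk hB hl (.sub h2 (.mul h2 (tame_leftBit hk hB (tame_unit hk hB hl)
      (tame_coord hk hB hl)))) h1)
    (tame_ifLt hB' (tame_unit hk hB hr) hn (tame_symbol hk hB hr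
      (.mul h2 (tame_rightBit hk hB (tame_unit hk hB hr) (tame_coord hk hB hr)))
      (.ofNat (by omega))) (.ofNat (by omega))))

end Tame

section Eval

variable {R n d r : ℕ} {reg mem : ℕ → ℕ}

theorem eval_symbol (hd : reg (R + 1) = d) (hr : reg (R + 2) = r) (s₀ s₁ p : Expr) :
    (symbol R s₀ s₁ p).eval reg mem = symbolAt d r (s₀.eval reg mem) (s₁.eval reg mem)
      (p.eval reg mem) := by
  subst hd hr
  simp only [symbol, eval_ifLt]
  rfl

/-- The expression `target` has the right value even if only the cells up to the address to be
written still hold the input: the symbol at an address depends on input words at smaller or equal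
addresses only. So the encoding of the sequences can replace the input from the top downward. -/
theorem eval_target (hn : reg R = n) (hd : reg (R + 1) = d) (hr : reg (R + 2) = r)
    (α β : Fin n → Fin d → Fin 2) {a : Expr}
    (ha : a.eval reg mem < 2 * seqLength n d r + 1)
    (hmem : ∀ b ≤ a.eval reg mem, mem b = (encodeVectors α β r).getD b 0) :
    (target R a).eval reg mem =
      (encodeSequences (leftFun α r) (rightFun β r)).getD (a.eval reg mem) 0 := by
  have hlen : (seqLen R).eval reg mem = seqLength n d r := by rw [← hn, ← hd, ← hr]; rfl
  have hL : d + 3 ≤ 4 * gadgetLength d r := by unfold gadgetLength; nlinarith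
  -- in the first sequence, the gadgets of the first list start beyond all words of this list; the
  -- second sequence starts beyond the whole input
  have hspace : 3 + n * d ≤ n * (4 * gadgetLength d r) ∨ n = 0 := by
    rcases Nat.eq_zero_or_pos n with h | h
    · exact .inr h
    · left; nlinarith
  rw [target, eval_ifLt, eval_ifLt, eval_add, hlen, eval_ofNat]
  generalize hA : a.eval reg mem = A at ha hmem ⊢
  split_ifs with h₀ h₁
  · obtain rfl : A = 0 := by omega
    rfl
  · obtain ⟨p, rfl⟩ := Nat.exists_eq_succ_of_ne_zero (show A ≠ 0 by omega)
    have hp : p < seqLength n d r := by omega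
    have hpe : (a - 1).eval reg mem = p := by rw [eval_sub, hA]; rfl
    have hval := (getD_encodeSequences (leftFun α r) (rightFun β r) ⟨p, hp⟩).1
    rw [hval, leftFun, val_leftSeq α hp, leftSymbol, eval_symbol hd hr, hpe]
    have hu : (unit R (a - 1)).eval reg mem = unitIndex d r p := by rw [← hpe, ← hd, ← hr]; rfl
    have hh : (coord R (a - 1)).eval reg mem = coordIndex d r p := by rw [← hpe, ← hd, ← hr]; rfl
    have hbit : (leftBit R (unit R (a - 1)) (coord R (a - 1))).eval reg mem =
        (unitBits α (unitIndex d r p) (coordIndex d r p)).toNat := by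
      simp only [leftBit, eval_ifLt, eval_mul, eval_load, eval_add, eval_sub, hu, hh]
      simp only [eval, hn, hd, unitBits]
      have hup : unitIndex d r p * (4 * gadgetLength d r) ≤ p := Nat.div_mul_le_self _ _
      generalize unitIndex d r p = u at hup ⊢
      generalize coordIndex d r p = h
      split_ifs with h₂ h₃ h₄ h₅ h₆
      · simp [not_le.2 h₃]
      · simp [not_lt.1 h₃]
      · rw [hmem, getD_encodeVectors_left α β r (by omega) h₅]
        have : n * (4 * gadgetLength d r) ≤ u * (4 * gadgetLength d r) :=
          Nat.mul_le_mul_right _ (not_lt.1 h₂)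
        have : (u - n) * d + h < n * d := by
          have : u - n + 1 ≤ n := by omega
          nlinarith
        omega
      · simp [natBits, h₅]
      · simp [not_le.2 h₆]
      · simp [not_lt.1 h₆]
    rw [eval_sub, eval_mul, hbit]
    rfl
  · obtain ⟨p, rfl⟩ := Nat.exists_eq_add_of_le
      (show 1 + seqLength n d r ≤ A by omega)
    have hp : p < seqLength n d r := by omega
    have hpe : (a - 1 - seqLen R).eval reg mem = p := by
      rw [eval_sub, eval_sub, hA, hlen, eval_ofNat]; omega
    have hval := (getD_encodeSequences (leftFun α r) (rightFun β r) ⟨p, hp⟩).2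
    rw [show 1 + seqLength n d r + p = p + 1 + seqLength n d r by omega, hval, rightFun,
      val_rightSeq β hp, rightSymbol, eval_ifLt]
    have hu : (unit R (a - 1 - seqLen R)).eval reg mem = unitIndex d r p := by
      rw [← hpe, ← hd, ← hr]; rfl
    have hh : (coord R (a - 1 - seqLen R)).eval reg mem = coordIndex d r p := by
      rw [← hpe, ← hd, ← hr]; rfl
    have hn' : (var R).eval reg mem = n := hn
    rw [hu, hn']
    split_ifs with h₂
    · rw [eval_symbol hd hr, hpe]
      have hbit : (rightBit R (unit R (a - 1 - seqLen R)) (coord R (a - 1 - seqLen R))).eval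
          reg mem = (natBits β (unitIndex d r p) (coordIndex d r p) ||
            decide (d ≤ coordIndex d r p)).toNat := by
        simp only [rightBit, eval_ifLt, eval_mul, eval_load, eval_add, hu, hh]
        simp only [eval, hn, hd]
        generalize unitIndex d r p = u at h₂ ⊢
        generalize coordIndex d r p = h
        split_ifs with h₃
        · rw [hmem, getD_encodeVectors_right α β r h₂ h₃]
          · simp [not_le.2 h₃]
          · have : u * d + h < n * d := by nlinarith
            have : seqLength n d r = 3 * (n * (4 * gadgetLength d r)) + 1 := by
              unfold seqLength; ring
            omega
        · simp [not_lt.1 h₃]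
      rw [eval_mul, hbit]
      rfl
    · rfl

end Eval

end Expr

/-! ### The reduction as a program -/

/-- Load `n`, `d` and `r`, and put the length of the encoding of the two sequences into register
`R + 3`. The registers below `R` are left at `0` for the program for the distance. -/
def prelude (R : ℕ) : List Instr :=
  (Expr.load 0).compile R ++ ((Expr.load 1).compile (R + 1) ++ ((Expr.load 2).compile (R + 2) ++
    (2 * Expr.seqLen R + 1).compile (R + 3)))

/-- Put `1` into register `0` if it holds less than the threshold in register `R + 5`, else
`0`, and stop. -/
def postlude (R : ℕ) : List Instr :=
  [.op .sub (R + 6) (R + 5) 0, .const (R + 7) 1, .op .sub (R + 6) (R + 7) (R + 6),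
    .op .sub 0 (R + 7) (R + 6), .halt]

/-- Write the encoding of the two sequences to the memory. -/
def writeSequences (R : ℕ) : List Instr :=
  fillLoop (prelude R).length (R + 3) (Expr.target R (.var (R + 4)))

/-- The part of the program before the program for the distance. -/
def preparation (R : ℕ) : List Instr :=
  prelude R ++ (writeSequences R ++ (Expr.threshold R).compile (R + 5))

/-- Most-Orthogonal Vectors by means of a program `P` for the distance that uses only registers
below `R`. -/
def reduction (R : ℕ) (P : Program) : Program :=
  preparation R ++ (P.map (Instr.relocate (preparation R).length
    ((preparation R).length + P.length)) ++ postlude R)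

/-- An exponent that bounds all values that occur before the program for the distance runs. -/
def reductionExponent (R : ℕ) : ℕ :=
  (Expr.target R (.var (R + 4))).size + (Expr.threshold R).size + (2 * Expr.seqLen R + 1).size + 2

/-- The number of steps of the reduction besides those of the program for the distance, per
symbol. -/
def reductionOverhead (R : ℕ) : ℕ :=
  (preparation R).length + 3 * (writeSequences R).length + 6

theorem run_prelude {w R B n d r : ℕ} {Q : Program} {mem : ℕ → ℕ} (hB : 4 ≤ B)
    (hmem : ∀ i, mem i ≤ B) (h0 : mem 0 = n) (h1 : mem 1 = d) (h2 : mem 2 = r)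
    (hw : B ^ reductionExponent R < 2 ^ w) (hQ : CodeAt Q 0 (prelude R)) :
    ∃ s, run w Q (prelude R).length ⟨0, fun _ => 0, mem⟩ = some s ∧ s.pc = (prelude R).length ∧
      s.mem = mem ∧ (∀ v < R, s.reg v = 0) ∧ s.reg R = n ∧ s.reg (R + 1) = d ∧
      s.reg (R + 2) = r ∧ s.reg (R + 3) = 2 * seqLength n d r + 1 := by
  have hpow : ∀ k ≤ reductionExponent R, B ^ k < 2 ^ w := fun k hk =>
    (Nat.pow_le_pow_right (by omega) hk).trans_lt hw
  have hone : B ^ 1 < 2 ^ w := hpow 1 (by unfold reductionExponent; omega)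
  obtain ⟨s₁, hs₁, hpc₁, hm₁, hv₁, hr₁⟩ := Expr.run_compile (w := w) (Q := Q) (k := R) (B := B)
    (dst := R) (e := .load 0) (s := ⟨0, fun _ => 0, mem⟩) (by omega) (by simp) hmem
    (Nat.zero_le B) le_rfl hone hQ.left
  simp only at hm₁ hr₁ hpc₁
  have hv₁ : s₁.reg R = n := by rw [hv₁]; exact h0
  have hn : n ≤ B := h0 ▸ hmem 0
  have hd : d ≤ B := h1 ▸ hmem 1
  have hr : r ≤ B := h2 ▸ hmem 2
  obtain ⟨s₂, hs₂, hpc₂, hm₂, hv₂, hr₂⟩ := Expr.run_compile (w := w) (Q := Q) (k := R) (B := B)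
    (dst := R + 1) (e := .load 1) (s := s₁) (by omega)
    (fun v hv => by rw [hr₁ v hv]; omega) (by rw [hm₁]; exact hmem)
    (show 1 ≤ B by omega) (by omega) hone (by rw [hpc₁]; exact hQ.right.left)
  have hv₂ : s₂.reg (R + 1) = d := by rw [hv₂, hm₁]; exact h1
  obtain ⟨s₃, hs₃, hpc₃, hm₃, hv₃, hr₃⟩ := Expr.run_compile (w := w) (Q := Q) (k := R) (B := B)
    (dst := R + 2) (e := .load 2) (s := s₂) (by omega)
    (fun v hv => by rw [hr₂ v (by omega), hr₁ v hv]; omega) (by rw [hm₂, hm₁]; exact hmem)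
    (show 2 ≤ B by omega) (by omega) hone (by rw [hpc₂, hpc₁]; exact hQ.right.right.left)
  have hv₃ : s₃.reg (R + 2) = r := by rw [hv₃, hm₂, hm₁]; exact h2
  have hn₃ : s₃.reg R = n := by rw [hr₃ R (by omega), hr₂ R (by omega), hv₁]
  have hd₃ : s₃.reg (R + 1) = d := by rw [hr₃ _ (by omega), hv₂]
  have hz₃ : ∀ v < R, s₃.reg v = 0 := fun v hv => by
    rw [hr₃ v (by omega), hr₂ v (by omega), hr₁ v hv]
  obtain ⟨s₄, hs₄, hpc₄, hm₄, hv₄, hr₄⟩ := Expr.run_compile (w := w) (Q := Q) (k := R + 3) (B := B)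
    (dst := R + 3) (e := 2 * Expr.seqLen R + 1) (s := s₃) (by omega)
    (fun v hv => by
      rcases (by omega : v < R ∨ v = R ∨ v = R + 1 ∨ v = R + 2) with h | rfl | rfl | rfl
      · rw [hz₃ v h]; omega
      · omega
      · omega
      · omega) (by rw [hm₃, hm₂, hm₁]; exact hmem)
    (.add (.mul (.ofNat (by omega)) (Expr.tame_seqLen le_rfl hB)) (.ofNat (by omega))) le_rfl
    (hpow _ (by unfold reductionExponent; omega))
    (by rw [hpc₃, hpc₂, hpc₁]; exact hQ.right.right.right)
  refine ⟨s₄, ?_, ?_, ?_, ?_, ?_, ?_, ?_, ?_⟩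
  · rw [prelude, List.length_append, List.length_append, List.length_append]
    exact run_trans hs₁ (run_trans hs₂ (run_trans hs₃ hs₄))
  · rw [hpc₄, hpc₃, hpc₂, hpc₁, prelude, List.length_append, List.length_append,
      List.length_append]
    omega
  · rw [hm₄, hm₃, hm₂, hm₁]
  · intro v hv; rw [hr₄ v (by omega), hz₃ v hv]
  · rw [hr₄ R (by omega), hn₃]
  · rw [hr₄ _ (by omega), hd₃]
  · rw [hr₄ _ (by omega), hv₃]
  · rw [hv₄, ← hn₃, ← hd₃, ← hv₃]; rfl

theorem run_postlude {w R T v : ℕ} {Q : Program} {s : State} (hT : T < 2 ^ w)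
    (hw : 1 < 2 ^ w) (hQ : CodeAt Q s.pc (postlude R)) (hv : s.reg 0 = v)
    (hTs : s.reg (R + 5) = T) :
    ∃ s', run w Q 4 s = some s' ∧ Q[s'.pc]? = some Instr.halt ∧
      s'.reg 0 = if v < T then 1 else 0 := by
  have h₀ := hQ.getElem? (i := 0) (by simp [postlude])
  have h₁ := hQ.getElem? (i := 1) (by simp [postlude])
  have h₂ := hQ.getElem? (i := 2) (by simp [postlude])
  have h₃ := hQ.getElem? (i := 3) (by simp [postlude])
  have h₄ := hQ.getElem? (i := 4) (by simp [postlude])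
  simp only [postlude, add_zero, List.getElem?_cons_zero, List.getElem?_cons_succ] at h₀ h₁ h₂ h₃ h₄
  refine ⟨⟨s.pc + 4, Function.update (Function.update (Function.update (Function.update s.reg
    (R + 6) (T - v)) (R + 7) 1) (R + 6) (1 - (T - v))) 0 (1 - (1 - (T - v))), s.mem⟩, ?_, h₄, ?_⟩
  · have b₁ : T - v < 2 ^ w := by omega
    have b₂ : 1 - (T - v) < 2 ^ w := by omega
    have b₃ : 1 - (1 - (T - v)) < 2 ^ w := by omega
    simp [run, step, h₀, h₁, h₂, h₃, State.setReg, BinOp.eval, hv, hTs, b₁, b₂, b₃, hw,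
      add_assoc]
  · simp only [Function.update_self]
    split <;> omega

theorem _root_.List.getD_zero_le {l : List ℕ} {B : ℕ} (h : ∀ a ∈ l, a ≤ B) (i : ℕ) :
    l.getD i 0 ≤ B := by
  rcases lt_or_ge i l.length with hi | hi
  · rw [List.getD_eq_getElem _ _ hi]; exact h _ (List.getElem_mem hi)
  · rw [List.getD_eq_default _ _ hi]; exact Nat.zero_le B

/-- The reduction decides whether the distance of the two sequences is below the threshold. Its
words have to be as long as those of the program `P` for the distance, and long enough for the
values that occur when the sequences are written. -/
theorem outputs_reduction {w₁ w R B n d r t v : ℕ} {P : Program} (hR : 0 < R)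
    (hP : ∀ I ∈ P, I.RegsLt R) (hn : 1 ≤ n) (α β : Fin n → Fin d → Fin 2)
    (hw₁ : w₁ ≤ w) (hB : 2 * seqLength n d r + 1 ≤ B) (hw : B ^ reductionExponent R < 2 ^ w)
    (h : Outputs w₁ P (encodeSequences (leftFun α r) (rightFun β r)) t v) :
    ∃ t' ≤ t + reductionOverhead R * seqLength n d r,
      Outputs w (reduction R P) (encodeVectors α β r) t'
        (if v < costThreshold n d r then 1 else 0) := by
  set N := seqLength n d r with hN
  set Q := reduction R P with hQdef
  set x := encodeSequences (leftFun α r) (rightFun β r) with hx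
  have hL : d + r + 5 ≤ 4 * gadgetLength d r := by unfold gadgetLength; nlinarith
  have hspace : 3 + 2 * (n * d) + n + d + r ≤ N := by
    have : N = 3 * (n * (4 * gadgetLength d r)) + 1 := by rw [hN]; unfold seqLength; ring
    have h₁ : n * (d + r + 5) ≤ n * (4 * gadgetLength d r) := Nat.mul_le_mul_left _ hL
    nlinarith [Nat.mul_le_mul hn (Nat.zero_le d), Nat.mul_le_mul_right d hn,
      Nat.mul_le_mul_right r hn]
  have hB4 : 4 ≤ B := by omega
  have hpow : ∀ k ≤ reductionExponent R, B ^ k < 2 ^ w := fun k hk =>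
    (Nat.pow_le_pow_right (by omega) hk).trans_lt hw
  have hBw : B < 2 ^ w := by simpa using hpow 1 (by unfold reductionExponent; omega)
  have hmemB : ∀ i, (encodeVectors α β r).getD i 0 ≤ B := by
    refine fun i => List.getD_zero_le (fun a ha => ?_) i
    simp only [encodeVectors, List.mem_cons, List.mem_append, List.mem_flatten,
      List.mem_ofFn] at ha
    rcases ha with rfl | rfl | rfl | ⟨l, ⟨i, rfl⟩, h⟩ | ⟨l, ⟨i, rfl⟩, h⟩
    · omega
    · omega
    · omega
    all_goals
      obtain ⟨k, rfl⟩ := List.mem_ofFn.1 h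
      omega
  have hxB : ∀ i, x.getD i 0 ≤ B := by
    refine fun i => List.getD_zero_le (fun a ha => ?_) i
    simp only [hx, encodeSequences, List.mem_cons, List.mem_append, List.mem_ofFn] at ha
    rcases ha with rfl | ⟨p, rfl⟩ | ⟨p, rfl⟩ <;> omega
  have hQ₀ : CodeAt Q 0 Q := ⟨[], [], by simp, rfl⟩
  have hQ₁ : CodeAt Q 0 (preparation R) := hQ₀.left
  -- the parameters
  obtain ⟨s₁, hs₁, hpc₁, hm₁, hz₁, hn₁, hd₁, hr₁, hi₁⟩ := run_prelude (n := n) (d := d) (r := r)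
    hB4 hmemB rfl rfl rfl hw hQ₁.left
  -- the sequences
  have hmem₁ : s₁.mem = fill (fun i => (encodeVectors α β r).getD i 0) (fun i => x.getD i 0)
      (2 * N + 1) (2 * N + 1) := by rw [fill_self, hm₁]
  have hvar : (Expr.var (R + 4)).Tame (R + 5) B := by simp only [Expr.Tame]; omega
  have hregs₁ : ∀ v < R + 3, s₁.reg v ≤ B := by
    intro v hv
    rcases (by omega : v < R ∨ v = R ∨ v = R + 1 ∨ v = R + 2) with h | rfl | rfl | rfl
    · rw [hz₁ v h]; omega
    · omega
    · omega
    · omega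
  have hQ₂ := hQ₁.right.left
  rw [zero_add] at hQ₂
  obtain ⟨s₂, hs₂, hpc₂, hr₂, hm₂⟩ := run_fillLoop (w := w) (R := R + 3)
    (E := Expr.target R (.var (R + 4))) (s := s₁) (reg := s₁.reg) (i := 2 * N + 1)
    (by omega) (Expr.tame_target (by omega) hB4 hvar)
    (hpow _ (by unfold reductionExponent; omega)) (hpow 2 (by unfold reductionExponent; omega))
    hQ₂ hpc₁ hi₁ le_rfl hB (fun _ _ => rfl) hregs₁ hmem₁ hmemB (fun i _ => hxB i)
    (by
      intro i hi reg' hreg' hi'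
      have hval := Expr.eval_target (R := R) (reg := reg') (a := .var (R + 4)) (mem := fill
        (fun i => (encodeVectors α β r).getD i 0) (fun i => x.getD i 0) (2 * N + 1) (i + 1))
        ((hreg' R (by omega)).trans hn₁) ((hreg' _ (by omega)).trans hd₁)
        ((hreg' _ (by omega)).trans hr₁) α β (by simpa only [Expr.eval, hi'] using hi)
        (by
          intro b hb
          simp only [Expr.eval, hi'] at hb
          rw [fill, if_neg (by omega)])
      rw [hval]
      simp only [Expr.eval, hi', hx])
  have hm₂' : s₂.mem = (init x).mem := by
    rw [hm₂]
    funext j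
    simp only [fill, init, Nat.zero_le, true_and]
    split_ifs with hj
    · rfl
    · rw [List.getD_eq_default _ _ (by rw [length_encodeVectors]; omega),
        List.getD_eq_default _ _ (by rw [hx, length_encodeSequences]; omega)]
  -- the threshold
  have hQ₃ := hQ₁.right.right
  rw [zero_add] at hQ₃
  obtain ⟨s₃, hs₃, hpc₃, hm₃, hv₃, hr₃⟩ := Expr.run_compile (w := w) (Q := Q) (k := R + 3) (B := B)
    (dst := R + 5) (e := Expr.threshold R) (s := s₂) (by omega)
    (fun v hv => by rw [hr₂ v hv]; exact hregs₁ v hv)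
    (by rw [hm₂']; exact hxB) (Expr.tame_threshold le_rfl hB4) (by omega)
    (hpow _ (by unfold reductionExponent; omega)) (by rw [hpc₂]; exact hQ₃)
  have hT : s₃.reg (R + 5) = costThreshold n d r := by
    rw [hv₃, ← hn₁, ← hd₁, ← hr₁, ← hr₂ R (by omega), ← hr₂ (R + 1) (by omega),
      ← hr₂ (R + 2) (by omega)]
    rfl
  have hTw : costThreshold n d r < 2 ^ w := by
    rw [← hT, hv₃]
    refine lt_of_le_of_lt (Expr.eval_le_pow (k := R + 3) (B := B) (by omega)
      (fun v hv => by rw [hr₂ v hv]; exact hregs₁ v hv) (by rw [hm₂']; exact hxB)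
      (Expr.tame_threshold le_rfl hB4)) (hpow _ (by unfold reductionExponent; omega))
  have hpc₃' : s₃.pc = (preparation R).length := by
    rw [hpc₃, hpc₂, preparation, List.length_append, List.length_append, writeSequences]
    omega
  -- the distance
  obtain ⟨s, hs, hhalt, hv⟩ := h
  have hQ₄ := hQ₀.right
  rw [zero_add] at hQ₄
  have hsim : Simulates (preparation R).length R (init x) s₃ := by
    refine ⟨by rw [hpc₃']; simp [init], by rw [hm₃, hm₂'], fun v hv => ?_⟩
    rw [hr₃ v (by omega), hr₂ v (by omega), hz₁ v hv]
    rfl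
  obtain ⟨s₄, hs₄, hsim₄, hr₄⟩ := hsim.run hw₁ hP hQ₄.left hs
  obtain ⟨s₅, hs₅, hpc₅, hreg₅⟩ : ∃ s₅, run w Q 1 s₄ = some s₅ ∧
      s₅.pc = (preparation R).length + P.length ∧ s₅.reg = s₄.reg := by
    refine ⟨⟨(preparation R).length + P.length, s₄.reg, s₄.mem⟩, run_one ?_, rfl, rfl⟩
    have hlt : s.pc < P.length := (List.getElem?_eq_some_iff.1 hhalt).1
    have hI : Q[s₄.pc]? = some (.jump ((preparation R).length + P.length)) := by
      rw [hsim₄.pc, add_comm, hQ₄.left.getElem? (by simpa using hlt), List.getElem?_map, hhalt]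
      rfl
    rw [step, hI]
  -- the comparison
  obtain ⟨s₆, hs₆, hhalt₆, hv₆⟩ := run_postlude (w := w) (Q := Q) (s := s₅) (v := v) hTw
    (by omega)
    (by
      have := hQ₄.right
      rw [List.length_map] at this
      rw [hpc₅]; exact this)
    (by rw [hreg₅, hsim₄.reg 0 hR, hv]) (by rw [hreg₅, hr₄ _ (by omega), hT])
  refine ⟨_, ?_, s₆, run_trans hs₁ (run_trans hs₂ (run_trans hs₃ (run_trans hs₄
    (run_trans hs₅ hs₆)))), hhalt₆, hv₆⟩
  have hN1 : 1 ≤ N := by omega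
  have hprep : (preparation R).length = (prelude R).length + ((writeSequences R).length +
      ((Expr.threshold R).compile (R + 5)).length) := by
    rw [preparation, List.length_append, List.length_append]
  rw [reductionOverhead, hprep]
  have hloop : (fillLoop (prelude R).length (R + 3) (Expr.target R (.var (R + 4)))).length =
    (writeSequences R).length := rfl
  rw [hloop]
  generalize (prelude R).length = a
  generalize (writeSequences R).length = b
  generalize ((Expr.threshold R).compile (R + 5)).length = e
  nlinarith [Nat.mul_le_mul_left a hN1, Nat.mul_le_mul_left b hN1, Nat.mul_le_mul_left e hN1]

end WordRAM

/-! ### Size bounds -/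

theorem seqLength_le {n d r : ℕ} (hn : 1 ≤ n) (hd : 1 ≤ d) (hr : r ≤ d) :
    seqLength n d r ≤ 505 * n * d ^ 2 := by
  have hL : gadgetLength d r ≤ 42 * d ^ 2 := by
    have h₁ : d + r + 1 ≤ 3 * d := by omega
    have h₂ : 2 * (2 * (d + r + 1)) + 2 ≤ 14 * d := by omega
    calc gadgetLength d r ≤ 3 * d * (14 * d) := Nat.mul_le_mul h₁ h₂
      _ = 42 * d ^ 2 := by ring
  have h₁ : 1 ≤ n * d ^ 2 := Nat.mul_pos hn (by positivity)
  calc seqLength n d r = 12 * n * gadgetLength d r + 1 := by unfold seqLength; ring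
    _ ≤ 12 * n * (42 * d ^ 2) + n * d ^ 2 := by gcongr
    _ = 505 * n * d ^ 2 := by ring

theorem seqLength_le_pow {n d r : ℕ} (hn : 1 ≤ n) (hd : 1 ≤ d) (hr : r ≤ d) :
    2 * seqLength n d r + 2 ≤ (2 * (n * d) + 4) ^ 7 := by
  have h := seqLength_le hn hd hr
  set x := 2 * (n * d) + 4 with hx
  have hnd : 1 ≤ n * d := Nat.mul_pos hn hd
  have h₁ : n * d ≤ x := by omega
  have h₂ : d ≤ x := le_trans (Nat.le_mul_of_pos_left d hn) h₁
  have h₃ : 505 * n * d ^ 2 ≤ 505 * x ^ 2 := by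
    calc 505 * n * d ^ 2 = 505 * ((n * d) * d) := by ring
      _ ≤ 505 * (x * x) := by gcongr
      _ = 505 * x ^ 2 := by ring
  have h₄ : 6 ^ 5 ≤ x ^ 5 := Nat.pow_le_pow_left (by omega) 5
  calc 2 * seqLength n d r + 2 ≤ 2 * (505 * x ^ 2) + 2 := by omega
    _ ≤ 6 ^ 5 * x ^ 2 := by nlinarith [Nat.pow_le_pow_left (show 6 ≤ x by omega) 2]
    _ ≤ x ^ 5 * x ^ 2 := by gcongr
    _ = x ^ 7 := by ring

theorem rpow_seqLength_le {n d r : ℕ} (hn : 1 ≤ n) (hd : 1 ≤ d) (hr : r ≤ d) {e : ℝ}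
    (h₀ : 0 ≤ e) (h₂ : e ≤ 2) :
    (seqLength n d r : ℝ) ^ e ≤ 505 ^ 2 * (n : ℝ) ^ e * (d : ℝ) ^ 4 := by
  have hd' : (1 : ℝ) ≤ d := by exact_mod_cast hd
  have h : (seqLength n d r : ℝ) ≤ 505 * n * d ^ 2 := by exact_mod_cast seqLength_le hn hd hr
  calc (seqLength n d r : ℝ) ^ e ≤ (505 * n * d ^ 2 : ℝ) ^ e :=
        Real.rpow_le_rpow (by positivity) h h₀
    _ = 505 ^ e * (n : ℝ) ^ e * ((d : ℝ) ^ 2) ^ e := by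
        rw [Real.mul_rpow (by positivity) (by positivity),
          Real.mul_rpow (by positivity) (by positivity)]
    _ ≤ 505 ^ (2 : ℝ) * (n : ℝ) ^ e * ((d : ℝ) ^ 2) ^ (2 : ℝ) := by
        have h₁ : (505 : ℝ) ^ e ≤ 505 ^ (2 : ℝ) :=
          Real.rpow_le_rpow_of_exponent_le (by norm_num) h₂
        have h₂ : ((d : ℝ) ^ 2) ^ e ≤ ((d : ℝ) ^ 2) ^ (2 : ℝ) :=
          Real.rpow_le_rpow_of_exponent_le (one_le_pow₀ hd') h₂
        gcongr
    _ = 505 ^ 2 * (n : ℝ) ^ e * (d : ℝ) ^ 4 := by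
        rw [Real.rpow_two, Real.rpow_two, ← pow_mul]

theorem mainTheorem4 (hDTWD : DTWDStronglySubquadratic 5) :
    MostOrthogonalVectorsTrulySubquadratic := by
  obtain ⟨ε, hε, C, c, P, hP⟩ := hDTWD
  obtain ⟨R', hR'⟩ := WordRAM.exists_forall_regsLt P
  obtain ⟨R, hR0, hR⟩ : ∃ R, 0 < R ∧ ∀ I ∈ P, I.RegsLt R :=
    ⟨R' + 1, Nat.succ_pos R', fun I hI => (hR' I hI).mono (Nat.le_succ R')⟩
  obtain ⟨D, hD⟩ : ∃ D, D = WordRAM.reductionOverhead R := ⟨_, rfl⟩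
  obtain ⟨S, hS⟩ : ∃ S, S = WordRAM.reductionExponent R := ⟨_, rfl⟩
  -- a saving of more than `1` in the exponent is lost to the time for writing the sequences
  obtain ⟨ε', hε'⟩ : ∃ ε', ε' = min ε 1 := ⟨_, rfl⟩
  have hε1 : ε' ≤ 1 := hε' ▸ min_le_right _ _
  have hεε : ε' ≤ ε := hε' ▸ min_le_left _ _
  have hε0 : 0 < ε' := hε' ▸ lt_min hε one_pos
  -- the sequences have length `N ≤ 505 * n * d ^ 2`, so `N ^ (2 - ε')` leaves a factor `d ^ 4`; if `x`
  -- is the length of the input plus `1`, then `2 * N + 2 ≤ x ^ 7`, whence the factors `7`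
  refine ⟨ε', hε0, (|C| + D) * 505 ^ 2, 4, 7 * c + (7 * S + 1),
    WordRAM.reduction R P, ?_⟩
  intro n d r hn hd hr α β
  have hN1 : 1 ≤ seqLength n d r := by unfold seqLength; omega
  obtain ⟨t, v, hout, hv, ht⟩ := hP _ hN1 (leftFun α r) (rightFun β r)
  obtain ⟨x, hx⟩ : ∃ x, x = 2 * (n * d) + 4 := ⟨_, rfl⟩
  have hlen : (encodeVectors α β r).length + 1 = x := by rw [length_encodeVectors]; omega
  have hpow := seqLength_le_pow hn hd hr
  rw [← hx] at hpow
  have hclog : Nat.clog 2 (2 * seqLength n d r + 2) ≤ 7 * Nat.clog 2 x := by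
    refine (Nat.clog_le_iff_le_pow one_lt_two).2 ?_
    rw [Nat.mul_comm 7, pow_mul]
    exact hpow.trans (Nat.pow_le_pow_left (Nat.le_pow_clog one_lt_two x) 7)
  have hw : WordRAM.wordSize c (encodeSequences (leftFun α r) (rightFun β r)) ≤
      WordRAM.wordSize (7 * c + (7 * S + 1)) (encodeVectors α β r) := by
    rw [WordRAM.wordSize, WordRAM.wordSize, hlen, length_encodeSequences]
    calc _ ≤ c * (7 * Nat.clog 2 x) := Nat.mul_le_mul_left _ hclog
      _ ≤ _ := by rw [add_mul]; nlinarith [Nat.zero_le ((7 * S + 1) * Nat.clog 2 x)]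
  have hB : (x ^ 7) ^ S < 2 ^ WordRAM.wordSize (7 * c + (7 * S + 1)) (encodeVectors α β r) := by
    rw [WordRAM.wordSize, hlen, ← pow_mul]
    calc x ^ (7 * S) < x ^ (7 * S + 1) := Nat.pow_lt_pow_right (by omega) (by omega)
      _ ≤ (2 ^ Nat.clog 2 x) ^ (7 * S + 1) :=
        Nat.pow_le_pow_left (Nat.le_pow_clog (by norm_num) x) _
      _ = 2 ^ ((7 * S + 1) * Nat.clog 2 x) := by rw [← pow_mul, mul_comm]
      _ ≤ _ := Nat.pow_le_pow_right (by norm_num) (Nat.mul_le_mul_right _ (by omega))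
  obtain ⟨t', ht', hout'⟩ := WordRAM.outputs_reduction hR0 hR hn α β hw
    (by omega : 2 * seqLength n d r + 1 ≤ x ^ 7) (hS ▸ hB) hout
  rw [← hD] at ht'
  rw [isDTWD_iff, ofFn_leftFun, ofFn_rightFun] at hv
  have hiff := hasFarPair_iff α β hv
  refine ⟨t', _, hout', fun h => if_pos (hiff.1 h), fun h => if_neg (mt hiff.2 h), ?_⟩
  have hN1' : (1 : ℝ) ≤ seqLength n d r := by exact_mod_cast hN1
  have h₁ : (t : ℝ) ≤ |C| * (seqLength n d r : ℝ) ^ (2 - ε') := by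
    calc (t : ℝ) ≤ C * (seqLength n d r : ℝ) ^ (2 - ε) := ht
      _ ≤ |C| * (seqLength n d r : ℝ) ^ (2 - ε) := by
        gcongr; exact le_abs_self C
      _ ≤ _ := by
        refine mul_le_mul_of_nonneg_left ?_ (abs_nonneg C)
        exact Real.rpow_le_rpow_of_exponent_le hN1' (by linarith)
  have h₂ : (seqLength n d r : ℝ) ≤ (seqLength n d r : ℝ) ^ (2 - ε') := by
    nth_rewrite 1 [← Real.rpow_one (seqLength n d r : ℝ)]
    exact Real.rpow_le_rpow_of_exponent_le hN1' (by linarith)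
  calc (t' : ℝ) ≤ t + D * seqLength n d r := by exact_mod_cast ht'
    _ ≤ |C| * (seqLength n d r : ℝ) ^ (2 - ε') + D * (seqLength n d r : ℝ) ^ (2 - ε') := by
      gcongr
    _ = (|C| + D) * (seqLength n d r : ℝ) ^ (2 - ε') := by ring
    _ ≤ (|C| + D) * (505 ^ 2 * (n : ℝ) ^ (2 - ε') * (d : ℝ) ^ 4) := by
      gcongr
      exact rpow_seqLength_le hn hd hr (by linarith) (by linarith)
    _ = (|C| + D) * 505 ^ 2 * (n : ℝ) ^ (2 - ε') * (d : ℝ) ^ 4 := by ring
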